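/- **Setting.** Let $\Omega\subset\mathbb R^3$ be a bounded open polyhedron and let $\Gamma_D\subset\partial\Omega$. A *mesh* of $\Omega$ is a finite set of nondegenerate closed tetrahedra that cover $\overline\Omega$ and have pairwise disjoint interiors contained in $\Omega$; hanging nodes are allowed, and $\Gamma_D$ is a union of faces of the mesh. Write $h_K=\operatorname{diam}K$, let $\rho_K$ be the ratio of $h_K$ to the radius of the largest ball contained in $K$, and write $\mathcal M\prec\mathcal T$ if each element of $\mathcal M$ is the union of elements of $\mathcal T$. A mesh is *conforming* if each face of an element lies in $\partial\Omega$ or is a face of another element. Let $\mathcal M_0\prec\mathcal M_1\prec\dots\prec\mathcal M_L$ be meshes of $\Omega$, where $\mathcal M_{l+1}$ is obtained by subdividing some or all of the elements $K\in\mathcal M_l$ with $\ell(K)=l$; here the level $\ell(K)$ is the number of subdivisions that it took to generate $K$ from an element of $\mathcal M_0$. Let $\mathcal M_0=\widehat{\mathcal M}_0\prec\widehat{\mathcal M}_1\prec\dots\prec\widehat{\mathcal M}_L$ be conforming meshes of $\Omega$ with $\mathcal M_l\prec\widehat{\mathcal M}_l$ and $\{K\in\mathcal M_l:\ell(K)=l\}\subset\widehat{\mathcal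 M}_l$, and put $h_l=\max\{h_K:K\in\widehat{\mathcal M}_l\}$. The refinement zone $\omega_l$ is the interior of $\bigcup\{K\in\mathcal M_L:\ell(K)\ge l\}$. **Spaces.** $\mathbf U(\mathcal M_m)$ is the lowest order edge element space: the fields $\mathbf v\in\mathbf H_{\Gamma_D}(\mathbf{curl},\Omega)$ (square integrable with square integrable curl and zero tangential trace on $\Gamma_D$) that have the form $\mathbf a+\mathbf b\times\mathbf x$ on each $K\in\mathcal M_m$; or, on a mesh with hanging nodes, the span of basis functions $\mathbf b_E$, one for each active edge $E$, that are of this form on each element, have path integral $1$ along $E$ and $0$ along all other active edges and all edges contained in $\Gamma_D$, and whose path integrals along the remaining edges are any weights for which edge interpolation commutes with the gradient on continuous piecewise linear functions that vanish on $\Gamma_D$. (A vertex is *active* if it is neither in the relative interior of an edge or a face of the mesh nor on $\Gamma_D$; an edge is *active* if it is not contained in $\Gamma_D$ and each of its endpoints is active or on $\Gamma_D$. The curl is taken element by element, which for fields in $\mathbf H(\mathbf{curl},\Omega)$ is the usual curl.) For an edge $E=[p,q]$ of $\widehat{\mathcal M}_l$ let $\mathbf b_E$ be the nodal basis function on $\widehat{\mathcal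 M}_l$, that is $\mathbf b_E=\lambda_p\nabla\lambda_q-\lambda_q\nabla\lambda_p$ on each $K\in\widehat{\mathcal M}_l$ that has the edge $E$ ($\lambda$ denoting barycentric coordinates of $K$), and $\mathbf b_E=0$ on all other elements. Let the set of active edges $E$ of $\mathcal M_l$ that are edges of $\widehat{\mathcal M}_l$ and satisfy $\operatorname{supp}\mathbf b_E\subset\overline{\omega}_l$ be partitioned into classes $\mathcal E_l^1,\dots,\mathcal E_l^P$ such that any two distinct such edges of an element $K\in\mathcal M_l$, $K\subset\overline\omega_l$, belong to different classes, and let $\mathbf U_l^i=\operatorname{span}\{\mathbf b_E:E\in\mathcal E_l^i\}$. **Claim.** For each $\rho$ there is a constant $C>0$, depending only on $\rho$, such that the following holds in every such setting with $\rho_K\le\rho$ for all $K\in\mathcal M_l$, $0\le l\le L$. Let $0\le m\le l\le L$, $1\le i\le P$, $\mathbf v_m\in\mathbf U(\mathcal M_m)$ and $\mathbf u_l^i\in\mathbf U_l^i$. All norms and inner products are those of $L^2(\Omega)^3$. 1. If each of the steps $\widehat{\mathcal M}_k\to\widehat{\mathcal M}_{k+1}$ splits every tetrahedron into one and the same number $N$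 of tetrahedra of equal volume (as global regular refinement, $N=8$, and global bisection, $N=2$, do), and $\rho_K\le\rho$ also for all $K\in\widehat{\mathcal M}_k$, $0\le k\le L$, then $$(\mathbf{curl}\,\mathbf v_m,\mathbf{curl}\,\mathbf u_l^i)\le C\,h_l^{1/2}h_m^{-1/2}\,\|\mathbf{curl}\,\mathbf v_m\|\,\|\mathbf{curl}\,\mathbf u_l^i\|.$$ 2. If, for some $C_0>0$ and $0<\theta<1$, $C_0^{-1}\theta^k\le h_K\le C_0\theta^k$ for all $K\in\widehat{\mathcal M}_k$, $0\le k\le L$, then the bound in 1. holds with $C$ replaced by $C\,C_0$. 3. In all cases $$(\mathbf v_m,\mathbf u_l^i)\le C\,h_l\,\|\mathbf v_m\|\,\|\mathbf{curl}\,\mathbf u_l^i\|.$$ -/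

import Mathlib

open MeasureTheory
open scoped ContDiff RealInnerProductSpace

noncomputable section

namespace EdgeMG

/-- Euclidean three-space. -/
abbrev E3 : Type := EuclideanSpace ℝ (Fin 3)

/-! ### Vector calculus -/

/-- The cross product on `E3`. -/
def cross (a b : E3) : E3 := WithLp.toLp 2 (crossProduct a.ofLp b.ofLp)

/-- The `i`-th partial derivative of the `j`-th component of a vector field. -/
def pd (v : E3 → E3) (x : E3) (i j : Fin 3) : ℝ :=
  fderiv ℝ v x (EuclideanSpace.single i 1) j

/-- The curl of a vector field, pointwise. The fields to which it is applied are smooth test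
fields, or polynomial on each open element of a mesh; for the latter the curl is thus
defined off the null set formed by the faces of the mesh, and when such a field lies in
`H(curl; Ω)` this is its distributional curl. -/
def curl (v : E3 → E3) (x : E3) : E3 :=
  !₂[pd v x 1 2 - pd v x 2 1, pd v x 2 0 - pd v x 0 2, pd v x 0 1 - pd v x 1 0]

/-- The inner product of `L²(Ω)³`. -/
def innerL2 (Ω : Set E3) (f g : E3 → E3) : ℝ := ∫ x in Ω, ⟪f x, g x⟫

/-- The norm of `L²(Ω)³`. -/
def normL2 (Ω : Set E3) (f : E3 → E3) : ℝ := √(∫ x in Ω, ‖f x‖ ^ 2)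

/-- The space `H_{Γ_D}(curl; Ω)`: square integrable fields with a square integrable weak curl `w`
and vanishing tangential trace on `ΓD`. The trace condition is expressed by Green's formula, with
test fields that vanish near the rest of the boundary only. -/
def HcurlD (Ω ΓD : Set E3) : Set (E3 → E3) :=
  {v | MemLp v 2 (volume.restrict Ω) ∧
    ∃ w : E3 → E3, MemLp w 2 (volume.restrict Ω) ∧
      ∀ φ : E3 → E3, ContDiff ℝ ∞ φ → HasCompactSupport φ →
        Disjoint (tsupport φ) (closure (frontier Ω \ ΓD)) →
          innerL2 Ω v (curl φ) = innerL2 Ω w φ}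

/-! ### Tetrahedra and meshes -/

/-- A (nondegenerate) tetrahedron, given by its set of vertices. -/
def IsTet (K : Finset E3) : Prop :=
  K.card = 4 ∧ AffineIndependent ℝ ((↑) : K → E3)

/-- The closed simplex spanned by a finite set of points. -/
def body (K : Finset E3) : Set E3 := convexHull ℝ (K : Set E3)

/-- The diameter `h_K`. -/
def hK (K : Finset E3) : ℝ := Metric.diam (body K)

/-- The radius of the largest ball contained in `K`. -/
def inradius (K : Finset E3) : ℝ :=
  sSup {r : ℝ | 0 ≤ r ∧ ∃ c : E3, Metric.closedBall c r ⊆ body K}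

/-- The shape regularity measure `ρ_K`. -/
def shapeMeasure (K : Finset E3) : ℝ := hK K / inradius K

/-- A finite collection of (vertex sets of) tetrahedra. -/
abbrev Mesh : Type := Finset (Finset E3)

def IsVertex (T : Mesh) (p : E3) : Prop := ∃ K ∈ T, p ∈ K

def IsEdge (T : Mesh) (E : Finset E3) : Prop := E.card = 2 ∧ ∃ K ∈ T, E ⊆ K

def IsFace (T : Mesh) (F : Finset E3) : Prop := F.card = 3 ∧ ∃ K ∈ T, F ⊆ K

/-- `T` is a tetrahedral mesh of `Ω`, possibly with hanging nodes, that resolves `ΓD`. -/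
structure IsMesh (Ω ΓD : Set E3) (T : Mesh) : Prop where
  isTet : ∀ K ∈ T, IsTet K
  disjoint : ∀ K ∈ T, ∀ K' ∈ T, K ≠ K' → Disjoint (interior (body K)) (interior (body K'))
  cover : ⋃ K ∈ T, body K = closure Ω
  interior_subset : ∀ K ∈ T, interior (body K) ⊆ Ω
  resolves : ∃ S : Set (Finset E3), (∀ F ∈ S, IsFace T F) ∧ ΓD = ⋃ F ∈ S, body F

/-- A mesh of `Ω` is conforming if each face of each tetrahedron is contained in the boundary of
`Ω` or is a face of another tetrahedron. -/
def Conforming (Ω : Set E3) (T : Mesh) : Prop :=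
  ∀ K ∈ T, ∀ F ⊆ K, F.card = 3 → body F ⊆ frontier Ω ∨ ∃ K' ∈ T, K' ≠ K ∧ F ⊆ K'

/-- All shape regularity measures of the elements of `T` are bounded by `ρ`. -/
def ShapeRegular (ρ : ℝ) (T : Mesh) : Prop := ∀ K ∈ T, shapeMeasure K ≤ ρ

/-- Nesting `M ≺ T`: each element of `M` is the union of elements of `T`. -/
def Nested (M T : Mesh) : Prop :=
  ∀ K ∈ M, body K = ⋃ K' ∈ {K' | K' ∈ T ∧ body K' ⊆ body K}, body K'

/-- The mesh width `max h_K` of a mesh. -/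
def meshWidth (T : Mesh) : ℝ := sSup (hK '' (T : Set (Finset E3)))

/-- A vertex in the relative interior of an edge or of a face of the mesh. -/
def IsHanging (T : Mesh) (p : E3) : Prop :=
  IsVertex T p ∧ ∃ s, (IsEdge T s ∨ IsFace T s) ∧ p ∈ intrinsicInterior ℝ (body s)

def IsActiveVertex (ΓD : Set E3) (T : Mesh) (p : E3) : Prop :=
  IsVertex T p ∧ ¬ IsHanging T p ∧ p ∉ ΓD

/-- The active edges of a mesh; on a conforming mesh these are the edges not contained in `ΓD`. -/
def IsActiveEdge (ΓD : Set E3) (T : Mesh) (E : Finset E3) : Prop :=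
  IsEdge T E ∧ ¬ body E ⊆ ΓD ∧ ∀ p ∈ E, IsActiveVertex ΓD T p ∨ p ∈ ΓD

/-! ### Edge elements -/

/-- The lowest order edge element space in its standard form: the fields in `H_{Γ_D}(curl; Ω)` that
have the form `a + b × x` on each element. -/
def whitneySpace (Ω ΓD : Set E3) (T : Mesh) : Set (E3 → E3) :=
  {v | v ∈ HcurlD Ω ΓD ∧
    ∀ K ∈ T, ∃ a b : E3, ∀ x ∈ interior (body K), v x = a + cross b x}

/-- The path integral of the field `x ↦ a + b × x` along the segment from `r` to `s`. -/
def pathInt (a b r s : E3) : ℝ :=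
  ∫ t in (0 : ℝ)..1, ⟪a + cross b (r + t • (s - r)), s - r⟫

/-- The continuous piecewise linear functions on `T` that vanish on `ΓD`. -/
def lagrangeSpace (Ω ΓD : Set E3) (T : Mesh) : Set (E3 → ℝ) :=
  {f | ContinuousOn f (closure Ω) ∧ (∀ x ∈ ΓD, f x = 0) ∧
    ∀ K ∈ T, ∃ (c : ℝ) (g : E3), ∀ x ∈ body K, f x = c + ⟪g, x⟫}

/-- `[p, q]` is an active edge of `T`, oriented from `p` to `q`. -/
def IsActivePair (ΓD : Set E3) (T : Mesh) (p q : E3) : Prop :=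
  p ≠ q ∧ ∃ E, IsActiveEdge ΓD T E ∧ p ∈ E ∧ q ∈ E

/-- `b p q`, for the oriented active edges `[p, q]` of a mesh with hanging nodes, is a family of
edge element basis functions with path integrals `w p q r s` along the oriented edges `[r, s]` of the
mesh (the "weights" if `[r, s]` is not active). The basis functions are locally of the form
`a + b × x`, they are dual to the path integrals along the active edges, their path integrals
along edges in `ΓD` vanish, and the weights of the slave edges fit the commuting diagram property: the path integral of a discrete gradient along any
edge is the combination, by the weights, of its path integrals along the active edges. (Each active
edge occurs with both orientations in the sum, which accounts for the factor `1 / 2`.) -/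
structure IsNodalFamily (Ω ΓD : Set E3) (T : Mesh) (b : E3 → E3 → E3 → E3)
    (w : E3 → E3 → E3 → E3 → ℝ) : Prop where
  isLocal : ∀ p q, IsActivePair ΓD T p q → ∀ K ∈ T, ∃ a c : E3,
    (∀ x ∈ interior (body K), b p q x = a + cross c x) ∧
      ∀ r ∈ K, ∀ s ∈ K, pathInt a c r s = w p q r s
  swap : ∀ p q, IsActivePair ΓD T p q → ∀ r s, w q p r s = - w p q r s
  dual_self : ∀ p q, IsActivePair ΓD T p q → w p q p q = 1
  dual_other : ∀ p q, IsActivePair ΓD T p q → ∀ r s, IsActivePair ΓD T r s →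
    ¬ (r = p ∧ s = q) → ¬ (r = q ∧ s = p) → w p q r s = 0
  boundary : ∀ p q, IsActivePair ΓD T p q → ∀ K ∈ T, ∀ r ∈ K, ∀ s ∈ K,
    segment ℝ r s ⊆ ΓD → w p q r s = 0
  commuting : ∀ f ∈ lagrangeSpace Ω ΓD T, ∀ K ∈ T, ∀ r ∈ K, ∀ s ∈ K,
    f s - f r = (1 / 2) * ∑ᶠ e ∈ {e : E3 × E3 | IsActivePair ΓD T e.1 e.2},
      w e.1 e.2 r s * (f e.2 - f e.1)

/-- `U` is the edge element space on `T`: the standard one, or, as is appropriate if there are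
hanging nodes, the span of a family of basis functions attached to the active edges, with any
admissible choice of the weights of the slave edges. -/
def IsEdgeSpace (Ω ΓD : Set E3) (T : Mesh) (U : Set (E3 → E3)) : Prop :=
  U = whitneySpace Ω ΓD T ∨
    ∃ b w, IsNodalFamily Ω ΓD T b w ∧
      U = Submodule.span ℝ {f | ∃ p q, IsActivePair ΓD T p q ∧ f = b p q}

/-- The vertices of a tetrahedron as an affine basis of `E3`. -/
def baryBasis (K : Finset E3) (h : IsTet K) : AffineBasis K ℝ E3 where
  toFun := (↑)
  ind' := h.2
  tot' := (h.2.affineSpan_eq_top_iff_card_eq_finrank_add_one).2 (by simp [h.1])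

open Classical in
/-- The barycentric coordinate function of the tetrahedron `K` that belongs to its vertex `p`. -/
def bary (K : Finset E3) (p : E3) (x : E3) : ℝ :=
  if h : IsTet K ∧ p ∈ K then (baryBasis K h.1).coord ⟨p, h.2⟩ x else 0

/-- The nodal basis function of the edge element space on a conforming mesh attached to the edge
`[p, q]`, oriented from `p` to `q`: it equals `λ_p ∇λ_q - λ_q ∇λ_p` on each tetrahedron with
that edge, and vanishes on all others. -/
def edgeBasis (T : Mesh) (p q : E3) (x : E3) : E3 :=
  ∑ K ∈ T, Set.indicator {y | p ∈ K ∧ q ∈ K ∧ y ∈ interior (body K)}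
    (fun y => bary K p y • gradient (bary K q) y - bary K q y • gradient (bary K p) y) x

/-! ### The refinement hierarchy -/

/-- The level of an element of a refinement hierarchy. As only elements of level `l` are subdivided
in the step from `T l` to `T (l+1)`, the number of subdivisions that it took to generate an element
is the index of the first mesh in which it occurs. -/
def level (T : ℕ → Mesh) (K : Finset E3) : ℕ := sInf {k | K ∈ T k}

/-- The virtual refinement hierarchy `T 0 ≺ T 1 ≺ ⋯ ≺ T L` of meshes of `Ω`, where `T (l+1)` is
created by subdividing some or all of the elements of level `l` of `T l`. -/
structure IsRefinementHierarchy (Ω ΓD : Set E3) (L : ℕ) (T : ℕ → Mesh) : Prop where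
  isMesh : ∀ l ≤ L, IsMesh Ω ΓD (T l)
  nested : ∀ l < L, Nested (T l) (T (l + 1))
  refines : ∀ l < L, ∀ K ∈ T l, K ∉ T (l + 1) → level T K = l

/-- The accompanying sequence of globally refined meshes `That l`, on which
the nodal basis functions live. -/
structure IsCompanion (Ω ΓD : Set E3) (L : ℕ) (T That : ℕ → Mesh) : Prop where
  isMesh : ∀ l ≤ L, IsMesh Ω ΓD (That l)
  conforming : ∀ l ≤ L, Conforming Ω (That l)
  zero : That 0 = T 0
  nested : ∀ l < L, Nested (That l) (That (l + 1))
  nested' : ∀ l ≤ L, Nested (T l) (That l)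
  top_level : ∀ l ≤ L, ∀ K ∈ T l, level T K = l → K ∈ That l

/-- Quasi-uniformity with geometric decay:
`C₀⁻¹ θ ^ l ≤ h_K ≤ C₀ θ ^ l` for all elements of `That l`. -/
def QuasiUniform (L : ℕ) (That : ℕ → Mesh) (C₀ θ : ℝ) : Prop :=
  0 < C₀ ∧ 0 < θ ∧ θ < 1 ∧
    ∀ l ≤ L, ∀ K ∈ That l, C₀⁻¹ * θ ^ l ≤ hK K ∧ hK K ≤ C₀ * θ ^ l

/-- Each global refinement step splits every tetrahedron into `N` tetrahedra of the same volume,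
as regular refinement (`N = 8`) and bisection (`N = 2`) do. -/
def EqualSplitting (L : ℕ) (That : ℕ → Mesh) (N : ℕ) : Prop :=
  ∀ l < L, ∀ K ∈ That l, ∀ K' ∈ That (l + 1), body K' ⊆ body K →
    volume.real (body K) = N * volume.real (body K')

/-- The refinement zone `ω_l`. -/
def zone (L : ℕ) (T : ℕ → Mesh) (l : ℕ) : Set E3 :=
  interior (⋃ K ∈ {K | K ∈ T L ∧ l ≤ level T K}, body K)

/-- The (active) edges of `T l` inside the refinement zone: the support of the attached nodal
basis function is contained in the closure of `ω_l`. -/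
def zoneEdges (ΓD : Set E3) (L : ℕ) (T That : ℕ → Mesh) (l : ℕ) : Set (Finset E3) :=
  {E | IsActiveEdge ΓD (T l) E ∧ IsEdge (That l) E ∧
    ∀ p ∈ E, ∀ q ∈ E, p ≠ q → tsupport (edgeBasis (That l) p q) ⊆ closure (zone L T l)}

/-- A partition of the edges inside the refinement zone `ω_l` into classes such that no two edges
of an element of `T l` inside the zone are in the same class. -/
structure IsColouring (ΓD : Set E3) (L : ℕ) (T That : ℕ → Mesh) (l : ℕ) {P : ℕ}
    (cls : Fin P → Set (Finset E3)) : Prop where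
  union : ⋃ i, cls i = zoneEdges ΓD L T That l
  disjoint : ∀ i j, i ≠ j → Disjoint (cls i) (cls j)
  separated : ∀ K ∈ T l, body K ⊆ closure (zone L T l) → ∀ i,
    ∀ E ∈ cls i, ∀ E' ∈ cls i, E ⊆ K → E' ⊆ K → E = E'

/-- The span of the nodal basis functions of the mesh `T` that are attached to the edges in `S`
(with both orientations, which differ by a sign). -/
def edgeSpan (T : Mesh) (S : Set (Finset E3)) : Submodule ℝ (E3 → E3) :=
  Submodule.span ℝ {b | ∃ E ∈ S, ∃ p ∈ E, ∃ q ∈ E, p ≠ q ∧ b = edgeBasis T p q}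

end EdgeMG

end

/-! On a coarse element `K` of `T m` the curl of `v` is a constant vector, so only the integral of
`curl u` over `K` enters the product. A basis function of `That l` whose edge meets the interior of
`K` contributes nothing to this integral. All tetrahedra around the edge lie in `K`, and over them
the curl of the basis function has integral zero, as it must for a field with vanishing tangential
trace on the boundary of its support. Here this is a finite cancellation: volume times curl on one
tetrahedron is a signed combination of its vertices (`volume_smul_cross_bgrad`), and the signs at a
face shared by two tetrahedra are opposite (`sum_volume_smul_cross_eq_zero`).

The contributions that remain come from tetrahedra with a class edge that misses the interior of
`K`. They lie in a strip along the boundary of `K`, of relative volume at most `24 * ρ * κ`, where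
`κ` bounds the ratio of fine to coarse diameters (`sum_volume_outer_le`). Cauchy-Schwarz on `K`,
then over all `K`, gives the factor `√κ` (`IsClassField.innerL2_curl_le`). The separation of the
classes is essential: a tetrahedron carries at most one basis function of a class, so discarding the
cancelling functions amounts to discarding whole tetrahedra, and the remainder is controlled by the
norm of `curl u` itself.

It remains to compare `κ` with the ratio of the global mesh widths. Under equal splitting this is
done through volumes, under quasi-uniformity directly through diameters.

For the third bound, `u` is a multiple of a single edge function on each tetrahedron and is
pointwise bounded by the diameter times its curl (`norm_edgeLocal_le`). The tetrahedra that carry an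
edge of the class belong to `T l`, whose shape regularity is assumed. -/

namespace EdgeMG

/-! ### Vector algebra in three-space -/

/-- The scalar triple product. -/
noncomputable def tri (a b c : E3) : ℝ := ⟪a, cross b c⟫

theorem inner_eq_sum (x y : E3) : ⟪x, y⟫ = x 0 * y 0 + x 1 * y 1 + x 2 * y 2 := by
  rw [PiLp.inner_apply, Fin.sum_univ_three]
  simp only [RCLike.inner_apply, conj_trivial]
  ring

@[simp] theorem cross_zero_apply (a b : E3) : cross a b 0 = a 1 * b 2 - a 2 * b 1 := by
  simp [cross, cross_apply]

@[simp] theorem cross_one_apply (a b : E3) : cross a b 1 = a 2 * b 0 - a 0 * b 2 := by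
  simp [cross, cross_apply]

@[simp] theorem cross_two_apply (a b : E3) : cross a b 2 = a 0 * b 1 - a 1 * b 0 := by
  simp [cross, cross_apply]

theorem E3_ext {x y : E3} (h0 : x 0 = y 0) (h1 : x 1 = y 1) (h2 : x 2 = y 2) : x = y := by
  ext i
  fin_cases i
  · exact h0
  · exact h1
  · exact h2

theorem tri_eq (a b c : E3) : tri a b c = a 0 * (b 1 * c 2 - b 2 * c 1)
    + a 1 * (b 2 * c 0 - b 0 * c 2) + a 2 * (b 0 * c 1 - b 1 * c 0) := by
  simp [tri, inner_eq_sum]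

/-- Cramer's rule. -/
theorem tri_smul_eq (a b c x : E3) :
    tri a b c • x = ⟪x, a⟫ • cross b c + ⟪x, b⟫ • cross c a + ⟪x, c⟫ • cross a b := by
  apply E3_ext <;> simp [tri_eq, inner_eq_sum] <;> ring

theorem cross_cross_cross (a b c : E3) :
    cross (cross b c) (cross c a) = tri a b c • c := by
  apply E3_ext <;> simp [tri_eq] <;> ring

theorem cross_smul_smul (s t : ℝ) (a b : E3) : cross (s • a) (t • b) = (s * t) • cross a b := by
  apply E3_ext <;> simp <;> ring

theorem cross_anticomm (a b : E3) : cross b a = -cross a b := by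
  apply E3_ext <;> simp <;> ring

/-- The cross product of two vectors of a dual basis. -/
theorem tri_smul_cross_dual {a b c α β : E3} (h : tri a b c ≠ 0)
    (h1 : ⟪α, a⟫ = 1) (h2 : ⟪α, b⟫ = 0) (h3 : ⟪α, c⟫ = 0)
    (k1 : ⟪β, a⟫ = 0) (k2 : ⟪β, b⟫ = 1) (k3 : ⟪β, c⟫ = 0) :
    tri a b c • cross α β = c := by
  have e1 : tri a b c • α = cross b c := by rw [tri_smul_eq, h1, h2, h3]; simp
  have e2 : tri a b c • β = cross c a := by rw [tri_smul_eq, k1, k2, k3]; simp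
  have e3 := cross_smul_smul (tri a b c) (tri a b c) α β
  rw [e1, e2, cross_cross_cross, mul_smul] at e3
  exact (smul_right_injective E3 h e3).symm

theorem norm_cross_le (a b : E3) : ‖cross a b‖ ≤ ‖a‖ * ‖b‖ := by
  apply le_of_sq_le_sq _ (by positivity)
  rw [mul_pow, ← real_inner_self_eq_norm_sq, ← real_inner_self_eq_norm_sq,
    ← real_inner_self_eq_norm_sq]
  have : ⟪cross a b, cross a b⟫ + ⟪a, b⟫ ^ 2 = ⟪a, a⟫ * ⟪b, b⟫ := by
    simp only [inner_eq_sum, cross_zero_apply, cross_one_apply, cross_two_apply]; ring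
  nlinarith [sq_nonneg (⟪a, b⟫)]

theorem abs_tri_le (a b c : E3) : |tri a b c| ≤ ‖a‖ * ‖b‖ * ‖c‖ := by
  rw [tri, mul_assoc]
  exact (abs_real_inner_le_norm _ _).trans
    (mul_le_mul_of_nonneg_left (norm_cross_le _ _) (norm_nonneg _))

/-- A nonzero triple product from linear independence. -/
theorem tri_ne_zero_of_dual {a b c α β γ : E3}
    (h1 : ⟪α, a⟫ = 1) (h2 : ⟪α, b⟫ = 0) (h3 : ⟪α, c⟫ = 0)
    (k1 : ⟪β, a⟫ = 0) (k2 : ⟪β, b⟫ = 1) (k3 : ⟪β, c⟫ = 0)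
    (l1 : ⟪γ, a⟫ = 0) (l2 : ⟪γ, b⟫ = 0) (l3 : ⟪γ, c⟫ = 1) : tri a b c ≠ 0 := by
  intro h
  -- The product of the two determinants is the determinant of the matrix of pairings, here the
  -- identity.
  have e : tri α β γ * tri a b c = 1 := by
    have : tri α β γ * tri a b c =
      ⟪α, a⟫ * (⟪β, b⟫ * ⟪γ, c⟫ - ⟪β, c⟫ * ⟪γ, b⟫) - ⟪α, b⟫ * (⟪β, a⟫ * ⟪γ, c⟫ - ⟪β, c⟫ * ⟪γ, a⟫)
        + ⟪α, c⟫ * (⟪β, a⟫ * ⟪γ, b⟫ - ⟪β, b⟫ * ⟪γ, a⟫) := by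
      simp only [inner_eq_sum, tri_eq]; ring
    rw [this, h1, h2, h3, k1, k2, k3, l1, l2, l3]; norm_num
  rw [h, mul_zero] at e
  exact zero_ne_one e

/-! ### Barycentric coordinates -/

variable {K : Finset E3}

theorem bary_eq_coord (h : IsTet K) {p : E3} (hp : p ∈ K) :
    bary K p = (baryBasis K h).coord ⟨p, hp⟩ := by
  funext x
  simp [bary, h, hp]

@[simp] theorem baryBasis_apply (h : IsTet K) (p : K) : baryBasis K h p = p := rfl

theorem bary_self (h : IsTet K) {p : E3} (hp : p ∈ K) : bary K p p = 1 := by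
  rw [bary_eq_coord h hp]
  exact (baryBasis K h).coord_apply_eq ⟨p, hp⟩

theorem bary_ne (h : IsTet K) {p q : E3} (hp : p ∈ K) (hq : q ∈ K) (hpq : p ≠ q) :
    bary K p q = 0 := by
  rw [bary_eq_coord h hp]
  exact (baryBasis K h).coord_apply_ne (i := ⟨p, hp⟩) (j := ⟨q, hq⟩) (by simpa using hpq)

theorem sum_bary (h : IsTet K) (x : E3) : ∑ p ∈ K, bary K p x = 1 := by
  rw [← Finset.sum_coe_sort, ← (baryBasis K h).sum_coord_apply_eq_one x]
  exact Finset.sum_congr rfl fun p _ => by rw [bary_eq_coord h p.2]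

theorem range_baryBasis (h : IsTet K) : Set.range (baryBasis K h) = (K : Set E3) := by
  ext x
  simp

theorem mem_body_iff (h : IsTet K) {x : E3} : x ∈ body K ↔ ∀ p ∈ K, 0 ≤ bary K p x := by
  rw [body, ← range_baryBasis h, AffineBasis.convexHull_eq_nonneg_coord]
  simp only [Set.mem_ofPred_eq, Subtype.forall]
  exact forall₂_congr fun p hp => by rw [bary_eq_coord h hp]

theorem mem_interior_body_iff (h : IsTet K) {x : E3} :
    x ∈ interior (body K) ↔ ∀ p ∈ K, 0 < bary K p x := by
  rw [body, ← range_baryBasis h, AffineBasis.interior_convexHull]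
  simp only [Set.mem_ofPred_eq, Subtype.forall]
  exact forall₂_congr fun p hp => by rw [bary_eq_coord h hp]

/-- The gradient of a barycentric coordinate function. -/
noncomputable def bgrad (K : Finset E3) (p : E3) : E3 := gradient (bary K p) 0

/-- A barycentric coordinate is affine, so the Riesz representative of its linear part gives all its
increments exactly. This makes the base point `0` in `bgrad` immaterial. -/
theorem hasGradientAt_bary_aux (h : IsTet K) {p : E3} (hp : p ∈ K) :
    ∃ g : E3, ∀ x, HasGradientAt (bary K p) g x ∧ ∀ y, bary K p y - bary K p x = ⟪g, y - x⟫ := by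
  set f := (baryBasis K h).coord ⟨p, hp⟩ with hf
  refine ⟨(InnerProductSpace.toDual ℝ E3).symm f.linear.toContinuousLinearMap, fun x => ?_⟩
  have key : ∀ x y, f y - f x
      = ⟪(InnerProductSpace.toDual ℝ E3).symm f.linear.toContinuousLinearMap, y - x⟫ := by
    intro x y
    rw [InnerProductSpace.toDual_symm_apply]
    exact (f.linearMap_vsub y x).symm
  rw [bary_eq_coord h hp]
  refine ⟨?_, key x⟩
  rw [hasGradientAt_iff_hasFDerivAt]
  have : (f : E3 → ℝ) = fun y => f 0 + f.linear.toContinuousLinearMap y := by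
    funext y
    have := key 0 y
    rw [InnerProductSpace.toDual_symm_apply] at this
    simp at this
    simp [← this]
  rw [← hf, this]
  simpa using (f.linear.toContinuousLinearMap.hasFDerivAt (x := x)).const_add (f 0)

theorem gradient_bary (h : IsTet K) {p : E3} (hp : p ∈ K) (x : E3) :
    gradient (bary K p) x = bgrad K p := by
  obtain ⟨g, hg⟩ := hasGradientAt_bary_aux h hp
  rw [bgrad, (hg x).1.gradient, (hg 0).1.gradient]

theorem bary_sub_bary (h : IsTet K) {p : E3} (hp : p ∈ K) (x y : E3) :
    bary K p y - bary K p x = ⟪bgrad K p, y - x⟫ := by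
  obtain ⟨g, hg⟩ := hasGradientAt_bary_aux h hp
  rw [bgrad, (hg 0).1.gradient, (hg x).2]

theorem hasFDerivAt_bary (h : IsTet K) {p : E3} (hp : p ∈ K) (x : E3) :
    HasFDerivAt (bary K p) (innerSL ℝ (bgrad K p)) x := by
  obtain ⟨g, hg⟩ := hasGradientAt_bary_aux h hp
  rw [bgrad, (hg 0).1.gradient]
  exact hasGradientAt_iff_hasFDerivAt.1 (hg x).1

/-! ### Bodies of tetrahedra -/

theorem mem_body {p : E3} (hp : p ∈ K) : p ∈ body K := subset_convexHull ℝ _ (by simpa using hp)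

theorem convex_body (K : Finset E3) : Convex ℝ (body K) := convex_convexHull ℝ _

theorem isCompact_body (K : Finset E3) : IsCompact (body K) :=
  K.finite_toSet.isCompact_convexHull (𝕜 := ℝ)

theorem isClosed_body (K : Finset E3) : IsClosed (body K) := (isCompact_body K).isClosed

theorem interior_body_nonempty (h : IsTet K) : (interior (body K)).Nonempty := by
  rw [body, ← range_baryBasis h]
  exact ⟨_, (baryBasis K h).centroid_mem_interior_convexHull⟩

theorem closure_interior_body (h : IsTet K) : closure (interior (body K)) = body K := by
  rw [(convex_body K).closure_interior_eq_closure_of_nonempty_interior (interior_body_nonempty h),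
    (isClosed_body K).closure_eq]

theorem body_nonempty (h : IsTet K) : (body K).Nonempty :=
  (interior_body_nonempty h).mono interior_subset

/-- A tetrahedron is the closure of its interior. This turns contact with an open set into overlap
of interiors, which is what the disjointness in `IsMesh` excludes. -/
theorem inter_interior_nonempty (h : IsTet K) {U : Set E3} (hU : IsOpen U) {x : E3} (hx : x ∈ U)
    (hxK : x ∈ body K) : (U ∩ interior (body K)).Nonempty := by
  rw [← closure_interior_body h] at hxK
  exact mem_closure_iff.1 hxK U hU hx

theorem dist_le_hK {x y : E3} (hx : x ∈ body K) (hy : y ∈ body K) : ‖x - y‖ ≤ hK K := by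
  rw [← dist_eq_norm]
  exact Metric.dist_le_diam_of_mem (isCompact_body K).isBounded hx hy

theorem hK_nonneg (K : Finset E3) : 0 ≤ hK K := Metric.diam_nonneg

theorem hK_mono {K K' : Finset E3} (h : body K ⊆ body K') : hK K ≤ hK K' :=
  Metric.diam_mono h (isCompact_body K').isBounded

theorem volume_frontier_body (K : Finset E3) : volume (frontier (body K)) = 0 :=
  (convex_body K).addHaar_frontier volume

theorem volume_body_ne_top (K : Finset E3) : volume (body K) ≠ ⊤ :=
  (isCompact_body K).measure_lt_top.ne

theorem interior_body_ae_eq (K : Finset E3) : interior (body K) =ᵐ[volume] body K :=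
  interior_ae_eq_of_null_frontier (volume_frontier_body K)

theorem volume_interior_body (K : Finset E3) :
    volume (interior (body K)) = volume (body K) := measure_congr (interior_body_ae_eq K)

theorem volume_real_body_pos (h : IsTet K) : 0 < volume.real (body K) := by
  refine ENNReal.toReal_pos ?_ (volume_body_ne_top K)
  rw [← volume_interior_body]
  exact (isOpen_interior.measure_pos volume (interior_body_nonempty h)).ne'

theorem volume_real_closedBall (x : E3) {r : ℝ} (hr : 0 ≤ r) :
    volume.real (Metric.closedBall x r) = r ^ 3 * volume.real (Metric.ball (0 : E3) 1) := by
  rw [Measure.addHaar_real_closedBall volume x hr]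
  simp

theorem volume_real_unitBall_pos : 0 < volume.real (Metric.ball (0 : E3) 1) :=
  ENNReal.toReal_pos (Metric.measure_ball_pos volume _ one_pos).ne' measure_ball_lt_top.ne

theorem volume_body_le (h : IsTet K) :
    volume.real (body K) ≤ hK K ^ 3 * volume.real (Metric.ball (0 : E3) 1) := by
  obtain ⟨x, hx⟩ := body_nonempty h
  rw [← volume_real_closedBall x (hK_nonneg K)]
  refine measureReal_mono (fun y hy => ?_) (isCompact_closedBall x _).measure_lt_top.ne
  rw [mem_closedBall_iff_norm]
  exact dist_le_hK hy hx

theorem hK_pos (h : IsTet K) : 0 < hK K := by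
  refine (hK_nonneg K).lt_of_ne fun h0 => ?_
  have := volume_body_le h
  rw [← h0] at this
  have := volume_real_body_pos h
  simp at *
  linarith

/-- A ball inside a shape regular tetrahedron, of comparable size. -/
theorem exists_closedBall_subset (h : IsTet K) {ρ : ℝ} (hρ : shapeMeasure K ≤ ρ) :
    ∃ r > 0, ∃ c, Metric.closedBall c r ⊆ body K ∧ hK K ≤ 2 * ρ * r := by
  set S := {r : ℝ | 0 ≤ r ∧ ∃ c : E3, Metric.closedBall c r ⊆ body K} with hS
  have hbdd : BddAbove S := by
    refine ⟨hK K, ?_⟩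
    rintro r ⟨hr, c, hc⟩
    have h1 : c + EuclideanSpace.single 0 r ∈ Metric.closedBall c r := by
      simp [abs_of_nonneg hr]
    have h2 : c ∈ Metric.closedBall c r := Metric.mem_closedBall_self hr
    have := dist_le_hK (hc h1) (hc h2)
    simpa [abs_of_nonneg hr] using this
  obtain ⟨x, hx⟩ := interior_body_nonempty h
  obtain ⟨ε, hε, hball⟩ := Metric.isOpen_iff.1 isOpen_interior x hx
  have hεS : ε / 2 ∈ S := by
    refine ⟨by positivity, x, ?_⟩
    exact ((Metric.closedBall_subset_ball (by linarith)).trans hball).trans interior_subset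
  have hpos : 0 < inradius K := lt_of_lt_of_le (by positivity) (le_csSup hbdd hεS)
  -- A radius above half the supremum suffices, so attainment is not needed; this is the origin of
  -- the factor 2 in every `2 * ρ`.
  obtain ⟨r, ⟨hr0, c, hc⟩, hr⟩ := exists_lt_of_lt_csSup ⟨_, hεS⟩ (half_lt_self hpos)
  have hrpos : 0 < r := lt_trans (by positivity) hr
  refine ⟨r, hrpos, c, hc, ?_⟩
  have h1 : hK K ≤ ρ * inradius K := by
    rw [shapeMeasure, div_le_iff₀ hpos] at hρ
    exact hρ
  have hρ0 : 0 < ρ := by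
    have := hK_pos h
    by_contra hcon
    nlinarith
  have hr' : inradius K < 2 * r := by
    have : inradius K / 2 < r := hr
    linarith
  nlinarith

theorem pos_of_shapeMeasure_le (h : IsTet K) {ρ : ℝ} (hρ : shapeMeasure K ≤ ρ) : 0 < ρ := by
  obtain ⟨r, hr, c, -, hle⟩ := exists_closedBall_subset h hρ
  have := hK_pos h
  by_contra hcon
  nlinarith

/-- Moving from the centre of the ball by `r` along the gradient raises the coordinate by `r *
‖bgrad K p‖`, while the coordinate stays between 0 and 1 on the tetrahedron. -/
theorem mul_norm_bgrad_le (h : IsTet K) {p c : E3} {r : ℝ} (hr : 0 ≤ r)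
    (hc : Metric.closedBall c r ⊆ body K) (hp : p ∈ K) : r * ‖bgrad K p‖ ≤ 1 := by
  by_cases hg : bgrad K p = 0
  · simp [hg]
  have hg' : 0 < ‖bgrad K p‖ := norm_pos_iff.2 hg
  have hbd : ∀ x ∈ body K, 0 ≤ bary K p x ∧ bary K p x ≤ 1 := by
    intro x hx
    rw [mem_body_iff h] at hx
    refine ⟨hx p hp, ?_⟩
    rw [← sum_bary h x]
    exact Finset.single_le_sum hx hp
  set y := c + (r / ‖bgrad K p‖) • bgrad K p with hy
  have hyb : y ∈ Metric.closedBall c r := by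
    rw [mem_closedBall_iff_norm, hy, add_sub_cancel_left, norm_smul, Real.norm_eq_abs,
      abs_of_nonneg (by positivity), div_mul_cancel₀ _ hg'.ne']
  have h1 := bary_sub_bary h hp c y
  rw [hy, add_sub_cancel_left, inner_smul_right, real_inner_self_eq_norm_sq, ← hy] at h1
  have h2 := (hbd y (hc hyb)).2
  have h3 := (hbd c (hc (Metric.mem_closedBall_self hr))).1
  have h4 : r / ‖bgrad K p‖ * ‖bgrad K p‖ ^ 2 = r * ‖bgrad K p‖ := by field_simp
  linarith

theorem bary_le_one (h : IsTet K) {p x : E3} (hp : p ∈ K) (hx : x ∈ body K) : bary K p x ≤ 1 := by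
  rw [mem_body_iff h] at hx
  rw [← sum_bary h x]
  exact Finset.single_le_sum hx hp

/-- The part of a tetrahedron close to one of its faces is small. -/
theorem volume_strip_le (h : IsTet K) {p : E3} (hp : p ∈ K) {t : ℝ} (ht : 0 ≤ t) :
    volume.real {x ∈ body K | bary K p x ≤ t} ≤ 3 * t * volume.real (body K) := by
  have hsub : {x ∈ body K | bary K p x ≤ t} ⊆ body K := fun x hx => hx.1
  have hfin := volume_body_ne_top K
  have hpos := volume_real_body_pos h
  by_cases h1 : 1 ≤ t
  · have := measureReal_mono hsub hfin
    nlinarith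
  push Not at h1
  -- Shrinking towards `p` by `1 - t` sends the interior into the part where the coordinate of `p`
  -- exceeds `t`. The strip is disjoint from this image, whose relative volume is `(1 - t) ^ 3`.
  set φ := AffineMap.homothety p (1 - t) with hφ
  have hφ_apply : ∀ x, φ x - p = (1 - t) • (x - p) := fun x => by
    simp [hφ, AffineMap.homothety_apply]
  have himage : φ '' interior (body K) ⊆ body K \ {x ∈ body K | bary K p x ≤ t} := by
    rintro _ ⟨x, hx, rfl⟩
    rw [mem_interior_body_iff h] at hx
    have hq : ∀ q ∈ K, bary K q (φ x) = bary K q p + (1 - t) * (bary K q x - bary K q p) := by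
      intro q hq
      have e1 := bary_sub_bary h hq p (φ x)
      rw [hφ_apply, inner_smul_right, ← bary_sub_bary h hq p x] at e1
      linarith
    have hpx : t < bary K p (φ x) := by
      rw [hq p hp, bary_self h hp]
      nlinarith [hx p hp]
    refine ⟨(mem_body_iff h).2 fun q hqK => ?_, fun hmem => absurd hmem.2 (not_le.2 hpx)⟩
    by_cases hqp : q = p
    · subst hqp; linarith
    · rw [hq q hqK, bary_ne h hqK hp hqp]
      nlinarith [hx q hqK]
  have hdisj : Disjoint (φ '' interior (body K)) {x ∈ body K | bary K p x ≤ t} :=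
    (Set.disjoint_sdiff_left).mono_left himage
  have hunion : φ '' interior (body K) ∪ {x ∈ body K | bary K p x ≤ t} ⊆ body K :=
    Set.union_subset (himage.trans Set.sdiff_subset) hsub
  have hmeas : MeasurableSet {x ∈ body K | bary K p x ≤ t} := by
    refine ((isClosed_body K).inter (IsClosed.preimage (f := bary K p) ?_ (isClosed_Iic (a := t)))).measurableSet
    exact continuous_iff_continuousAt.2 fun x => (hasFDerivAt_bary h hp x).continuousAt
  have e := measureReal_mono hunion hfin
  rw [measureReal_union hdisj hmeas (measure_ne_top_of_subset (himage.trans Set.sdiff_subset) hfin)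
    (measure_ne_top_of_subset hsub hfin)] at e
  have e2 : volume.real (φ '' interior (body K)) = (1 - t) ^ 3 * volume.real (body K) := by
    rw [measureReal_def, hφ, Measure.addHaar_image_homothety, ENNReal.toReal_mul,
      volume_interior_body, ENNReal.toReal_ofReal (abs_nonneg _), abs_of_nonneg (by
        apply pow_nonneg; linarith), measureReal_def]
    simp
  rw [e2] at e
  have e3 : 1 - 3 * t ≤ (1 - t) ^ 3 := by
    nlinarith [sq_nonneg t, mul_nonneg (sq_nonneg t) (by linarith : 0 ≤ 3 - t)]
  nlinarith

/-! ### The volume of a tetrahedron -/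

/-- The volume of the reference tetrahedron. -/
noncomputable def refVolume : ℝ := volume.real (convexHull ℝ ({0, EuclideanSpace.single 0 1,
  EuclideanSpace.single 1 1, EuclideanSpace.single 2 1} : Set E3))

/-- The tetrahedron is an affine image of the reference one, and the determinant of the linear part
is the triple product of the edge vectors. The value of `refVolume` plays no role, since it is a
common factor in the cancellation. -/
theorem volume_body_eq (p q r s : E3) :
    volume.real (convexHull ℝ ({p, q, r, s} : Set E3)) =
      |tri (q - p) (r - p) (s - p)| * refVolume := by
  set b := (EuclideanSpace.basisFun (Fin 3) ℝ).toBasis with hb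
  set M : Matrix (Fin 3) (Fin 3) ℝ := Matrix.of fun i j => ![q - p, r - p, s - p] j i with hM
  set A := Matrix.toLin b b M with hA
  have hAe : ∀ j, A (EuclideanSpace.single j 1) = ![q - p, r - p, s - p] j := by
    intro j
    have : b j = EuclideanSpace.single j 1 := by simp [hb]
    rw [← this, hA, Matrix.toLin_self]
    ext i
    fin_cases j <;> simp [hM, hb, Pi.single_apply]
  have himg : convexHull ℝ ({p, q, r, s} : Set E3) = (fun x => p + x) '' (A ''
      convexHull ℝ ({0, EuclideanSpace.single 0 1,
        EuclideanSpace.single 1 1, EuclideanSpace.single 2 1} : Set E3)) := by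
    rw [LinearMap.image_convexHull]
    have := (AffineEquiv.constVAdd ℝ E3 p).toAffineMap.image_convexHull
      (A '' ({0, EuclideanSpace.single 0 1,
        EuclideanSpace.single 1 1, EuclideanSpace.single 2 1} : Set E3))
    have e : ((AffineEquiv.constVAdd ℝ E3 p).toAffineMap : E3 → E3) = fun x => p + x := by
      funext x; simp
    rw [e] at this
    rw [this]
    congr 1
    simp [Set.image_insert_eq, hAe]
  have hdet : LinearMap.det A = tri (q - p) (r - p) (s - p) := by
    rw [hA, LinearMap.det_toLin, Matrix.det_fin_three, tri_eq]
    simp [hM]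
    ring
  rw [himg, refVolume, measureReal_def, Set.image_add_left, measure_preimage_add,
    Measure.addHaar_image_linearMap, ENNReal.toReal_mul, ENNReal.toReal_ofReal (abs_nonneg _), hdet,
    measureReal_def]

end EdgeMG

namespace EdgeMG

variable {K : Finset E3}

/-! ### Tetrahedra with a given edge -/

open Classical in
theorem exists_opposite_edge (h : IsTet K) {p q : E3} (hp : p ∈ K) (hq : q ∈ K) (hpq : p ≠ q) :
    ∃ r s, r ∈ K ∧ s ∈ K ∧ r ≠ s ∧ r ≠ p ∧ r ≠ q ∧ s ≠ p ∧ s ≠ q ∧ K = {p, q, r, s} := by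
  have hq' : q ∈ K.erase p := Finset.mem_erase.2 ⟨hpq.symm, hq⟩
  have hc : ((K.erase p).erase q).card = 2 := by
    rw [Finset.card_erase_of_mem hq', Finset.card_erase_of_mem hp, h.1]
  obtain ⟨r, s, hrs, hK⟩ := Finset.card_eq_two.1 hc
  have hr : r ∈ (K.erase p).erase q := by rw [hK]; simp
  have hs : s ∈ (K.erase p).erase q := by rw [hK]; simp
  simp only [Finset.mem_erase] at hr hs
  refine ⟨r, s, hr.2.2, hs.2.2, hrs, hr.2.1, hr.1, hs.2.1, hs.1, ?_⟩
  rw [← hK, Finset.insert_erase hq', Finset.insert_erase hp]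

open Classical in
theorem exists_opposite_vertex (h : IsTet K) {p q r : E3} (hp : p ∈ K) (hq : q ∈ K) (hr : r ∈ K)
    (hpq : p ≠ q) (hrp : r ≠ p) (hrq : r ≠ q) :
    ∃ s, s ∈ K ∧ s ≠ r ∧ s ≠ p ∧ s ≠ q ∧ K = {p, q, r, s} := by
  obtain ⟨a, b, ha, hb, hab, hap, haq, hbp, hbq, rfl⟩ := exists_opposite_edge h hp hq hpq
  simp only [Finset.mem_insert, Finset.mem_singleton, hrp, hrq, false_or] at hr
  rcases hr with rfl | rfl
  · exact ⟨b, hb, hab.symm, hbp, hbq, rfl⟩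
  · refine ⟨a, ha, hab, hap, haq, ?_⟩
    rw [Finset.pair_comm]

theorem inner_bgrad (h : IsTet K) {p a b : E3} (hp : p ∈ K) :
    ⟪bgrad K p, a - b⟫ = bary K p a - bary K p b := (bary_sub_bary h hp b a).symm

set_option linter.unusedSimpArgs false in
theorem tri_ne_zero (h : IsTet K) {p q r s : E3} (hp : p ∈ K) (hq : q ∈ K) (hr : r ∈ K)
    (hs : s ∈ K) (hpq : p ≠ q) (hrp : r ≠ p) (hrq : r ≠ q) (hsr : s ≠ r) (hsp : s ≠ p)
    (hsq : s ≠ q) : tri (q - p) (r - p) (s - p) ≠ 0 := by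
  apply tri_ne_zero_of_dual (α := bgrad K q) (β := bgrad K r) (γ := bgrad K s) <;>
  simp [inner_bgrad h, bary_self h, bary_ne h, hp, hq, hr, hs, hpq, hrp, hrq, hsr, hsp, hsq,
    hpq.symm, hrp.symm, hrq.symm, hsr.symm, hsp.symm, hsq.symm]

-- Relative to the vertex `s`, the gradients at `p`, `q`, `r` are dual to the edge vectors, so
-- `tri_smul_cross_dual` applies; moving the base point from `p` to `s` changes the sign of the
-- triple product.
set_option linter.unusedSimpArgs false in
theorem tri_smul_cross_bgrad (h : IsTet K) {p q r s : E3} (hp : p ∈ K) (hq : q ∈ K) (hr : r ∈ K)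
    (hs : s ∈ K) (hpq : p ≠ q) (hrp : r ≠ p) (hrq : r ≠ q) (hsr : s ≠ r) (hsp : s ≠ p)
    (hsq : s ≠ q) :
    tri (q - p) (r - p) (s - p) • cross (bgrad K p) (bgrad K q) = s - r := by
  have e : tri (q - p) (r - p) (s - p) = -tri (p - s) (q - s) (r - s) := by
    simp only [tri_eq, PiLp.sub_apply]; ring
  have hne := tri_ne_zero h hp hq hr hs hpq hrp hrq hsr hsp hsq
  rw [e] at hne ⊢
  rw [neg_smul, tri_smul_cross_dual (by simpa using hne), neg_sub] <;>
  simp [inner_bgrad h, bary_self h, bary_ne h, hp, hq, hr, hs, hpq, hrp, hrq, hsr, hsp, hsq,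
    hpq.symm, hrp.symm, hrq.symm, hsr.symm, hsp.symm, hsq.symm]

/-- The side of the plane through `p`, `q`, `r` on which the tetrahedron `K` with these vertices
lies. -/
noncomputable def side (p q : E3) (K : Finset E3) (r : E3) : ℝ :=
  ∑ s ∈ K, Real.sign (tri (q - p) (r - p) (s - p))

theorem tri_left_eq_zero (a b : E3) : tri a a b = 0 := by rw [tri_eq]; ring

theorem tri_right_eq_zero (a b : E3) : tri a b b = 0 := by rw [tri_eq]; ring

theorem tri_outer_eq_zero (a b : E3) : tri a b a = 0 := by rw [tri_eq]; ring

theorem tri_mid_zero (a b : E3) : tri a 0 b = 0 := by rw [tri_eq]; simp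

theorem tri_last_zero (a b : E3) : tri a b 0 = 0 := by rw [tri_eq]; simp

theorem side_left (p q : E3) (K : Finset E3) : side p q K p = 0 := by
  simp [side, tri_mid_zero]

theorem side_right (p q : E3) (K : Finset E3) : side p q K q = 0 := by
  simp [side, tri_left_eq_zero]

-- The triple product vanishes when `s` is one of `p`, `q`, `r`, and the sign of zero is zero. The
-- sum defining `side` thus selects the opposite vertex without a choice.
open Classical in
theorem side_eq {p q r s : E3}  (hpq : p ≠ q) (hrp : r ≠ p) (hrq : r ≠ q) (hsr : s ≠ r)
    (hsp : s ≠ p) (hsq : s ≠ q) :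
    side p q {p, q, r, s} r = Real.sign (tri (q - p) (r - p) (s - p)) := by
  rw [side, Finset.sum_insert, Finset.sum_insert, Finset.sum_insert, Finset.sum_singleton]
  · simp [tri_last_zero, tri_outer_eq_zero, tri_right_eq_zero]
  all_goals simp [hpq, hrp.symm, hrq.symm, hsr.symm, hsp.symm, hsq.symm]

theorem tri_swap (a b c : E3) : tri a c b = -tri a b c := by simp only [tri_eq]; ring

theorem abs_mul_sign (x : ℝ) : |x| = x * Real.sign x := by
  rcases lt_trichotomy x 0 with hx | rfl | hx
  · rw [Real.sign_of_neg hx, abs_of_neg hx]; ring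
  · simp
  · rw [Real.sign_of_pos hx, abs_of_pos hx]; ring

open Classical in
/-- The integral of the curl of an edge basis function over a tetrahedron with that edge. -/
theorem volume_smul_cross_bgrad (h : IsTet K) {p q : E3} (hp : p ∈ K) (hq : q ∈ K) (hpq : p ≠ q) :
    volume.real (body K) • cross (bgrad K p) (bgrad K q) =
      -(refVolume • ∑ r ∈ K, side p q K r • r) := by
  obtain ⟨r, s, hr, hs, hrs, hrp, hrq, hsp, hsq, hK⟩ := exists_opposite_edge h hp hq hpq
  have hvol : volume.real (body K) = |tri (q - p) (r - p) (s - p)| * refVolume := by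
    rw [← volume_body_eq, hK, body]; simp
  -- The vertices `p` and `q` have coefficient zero; those of `r` and `s` are opposite, since
  -- exchanging the two reverses the triple product.
  have hsum : ∑ x ∈ K, side p q K x • x
      = Real.sign (tri (q - p) (r - p) (s - p)) • (r - s) := by
    have h1 : side p q K r = Real.sign (tri (q - p) (r - p) (s - p)) := by
      rw [hK]; exact side_eq hpq hrp hrq hrs.symm hsp hsq
    have h2 : side p q K s = -Real.sign (tri (q - p) (r - p) (s - p)) := by
      rw [hK, Finset.pair_comm, side_eq hpq hsp hsq hrs hrp hrq, tri_swap, Real.sign_neg]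
    rw [smul_sub, ← h1, sub_eq_add_neg, ← neg_smul, h1, ← h2, ← h1]
    have hKs : ∑ x ∈ K, side p q K x • x =
        ∑ x ∈ ({p, q, r, s} : Finset E3), side p q K x • x := Finset.sum_congr hK fun _ _ => rfl
    rw [hKs, Finset.sum_insert, Finset.sum_insert, Finset.sum_insert, Finset.sum_singleton,
      side_left, side_right]
    · simp
    all_goals simp [hpq, hrp.symm, hrq.symm, hrs, hsp.symm, hsq.symm]
  rw [hvol, hsum, abs_mul_sign, mul_right_comm, mul_comm _ refVolume, mul_comm _ (Real.sign _),
    ← mul_assoc, mul_smul, tri_smul_cross_bgrad h hp hq hr hs hpq hrp hrq hrs.symm hsp hsq, mul_smul,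
    ← smul_neg, ← smul_neg, neg_sub, smul_comm]

/-- Two tetrahedra with a common face on the same side of it overlap. -/
theorem inter_interior_nonempty_of_same_side {K' : Finset E3} (h : IsTet K) (h' : IsTet K')
    {p q r s s' : E3} (hpq : p ≠ q) (hrp : r ≠ p) (hrq : r ≠ q) (hsr : s ≠ r) (hsp : s ≠ p)
    (hsq : s ≠ q) (hK : ∀ x, x ∈ K ↔ x = p ∨ x = q ∨ x = r ∨ x = s)
    (hsr' : s' ≠ r) (hsp' : s' ≠ p) (hsq' : s' ≠ q)
    (hK' : ∀ x, x ∈ K' ↔ x = p ∨ x = q ∨ x = r ∨ x = s')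
    (hside : 0 < tri (q - p) (r - p) (s - p) * tri (q - p) (r - p) (s' - p)) :
    (interior (body K) ∩ interior (body K')).Nonempty := by
  have hp := (hK p).2 (by simp)
  have hq := (hK q).2 (by simp)
  have hr := (hK r).2 (by simp)
  have hs := (hK s).2 (by simp)
  have hp' := (hK' p).2 (by simp)
  have hq' := (hK' q).2 (by simp)
  have hr' := (hK' r).2 (by simp)
  have hs' := (hK' s').2 (by simp)
  -- `s` and `s'` are on the same side
  have hpos : 0 < bary K s s' := by
    set D := tri (q - p) (r - p) (s - p) with hD
    -- By Cramer's rule, `D • bgrad K s` is the normal `cross (q - p) (r - p)`, because the gradient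
    -- annihilates both edge vectors of the common face.
    have e : D * ⟪bgrad K s, s' - p⟫ = tri (q - p) (r - p) (s' - p) := by
      have e1 := tri_smul_eq (q - p) (r - p) (s - p) (bgrad K s)
      have a1 : ⟪bgrad K s, q - p⟫ = 0 := by
        rw [inner_bgrad h hs, bary_ne h hs hq hsq, bary_ne h hs hp hsp, sub_zero]
      have a2 : ⟪bgrad K s, r - p⟫ = 0 := by
        rw [inner_bgrad h hs, bary_ne h hs hr hsr, bary_ne h hs hp hsp, sub_zero]
      have a3 : ⟪bgrad K s, s - p⟫ = 1 := by
        rw [inner_bgrad h hs, bary_self h hs, bary_ne h hs hp hsp, sub_zero]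
      rw [a1, a2, a3] at e1
      simp only [zero_smul, zero_add, one_smul] at e1
      rw [← real_inner_smul_left, e1]
      simp only [inner_eq_sum, tri_eq, cross_zero_apply, cross_one_apply, cross_two_apply]
      ring
    rw [inner_bgrad h hs, bary_ne h hs hp hsp, sub_zero] at e
    rw [← e] at hside
    have : 0 < D * D * bary K s s' := by linarith
    exact pos_of_mul_pos_right this (mul_self_nonneg D)
  -- a point near the barycentre of the common face
  set y : ℝ → E3 := fun t => p + ((1 - t) / 3) • (q - p) + ((1 - t) / 3) • (r - p) + t • (s' - p)
    with hy
  have hyK : ∀ M : Finset E3, IsTet M → ∀ a ∈ M, ∀ t, bary M a (y t) =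
      (1 - t) / 3 * bary M a p + (1 - t) / 3 * bary M a q + (1 - t) / 3 * bary M a r
        + t * bary M a s' := by
    intro M hM a ha t
    have e := bary_sub_bary hM ha p (y t)
    have e1 : y t - p = ((1 - t) / 3) • (q - p) + ((1 - t) / 3) • (r - p) + t • (s' - p) := by
      rw [hy]; simp only; abel
    rw [e1, inner_add_right, inner_add_right, inner_smul_right, inner_smul_right, inner_smul_right,
      inner_bgrad hM ha, inner_bgrad hM ha, inner_bgrad hM ha] at e
    linarith
  have hsmall : ∀ c : ℝ, ∀ᶠ t in nhdsWithin (0 : ℝ) (Set.Ioi 0), 0 < (1 - t) / 3 + t * c := by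
    intro c
    have : Filter.Tendsto (fun t : ℝ => (1 - t) / 3 + t * c) (nhdsWithin (0 : ℝ) (Set.Ioi 0))
        (nhds ((1 - 0) / 3 + 0 * c)) := by
      apply Filter.Tendsto.mono_left _ nhdsWithin_le_nhds
      apply Continuous.tendsto
      fun_prop
    exact this.eventually (lt_mem_nhds (by norm_num))
  -- The instance `hsmall 0` gives `t < 1`, which is what the coordinates in `K'` require; the other
  -- three concern `K`.
  obtain ⟨t, ⟨⟨⟨h1, h2⟩, h3⟩, h4⟩, h5⟩ := ((((hsmall (bary K p s')).and (hsmall (bary K q s'))).and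
    (hsmall (bary K r s'))).and (hsmall 0)).and (self_mem_nhdsWithin) |>.exists
  have ht : 0 < t := h5
  refine ⟨y t, (mem_interior_body_iff h).2 fun a ha => ?_,
    (mem_interior_body_iff h').2 fun a ha => ?_⟩
  · rw [hyK K h a ha]
    rcases (hK a).1 ha with rfl | rfl | rfl | rfl
    · rw [bary_self h ha, bary_ne h ha hq hpq, bary_ne h ha hr hrp.symm]; linarith
    · rw [bary_self h ha, bary_ne h ha hp hpq.symm, bary_ne h ha hr hrq.symm]; linarith
    · rw [bary_self h ha, bary_ne h ha hp hrp, bary_ne h ha hq hrq]; linarith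
    · rw [bary_ne h ha hp hsp, bary_ne h ha hq hsq, bary_ne h ha hr hsr]
      have := mul_pos ht hpos
      linarith
  · rw [hyK K' h' a ha]
    rcases (hK' a).1 ha with rfl | rfl | rfl | rfl
    · rw [bary_self h' ha, bary_ne h' ha hq' hpq, bary_ne h' ha hr' hrp.symm,
        bary_ne h' ha hs' hsp'.symm]; linarith
    · rw [bary_self h' ha, bary_ne h' ha hp' hpq.symm, bary_ne h' ha hr' hrq.symm,
        bary_ne h' ha hs' hsq'.symm]; linarith
    · rw [bary_self h' ha, bary_ne h' ha hp' hrp, bary_ne h' ha hq' hrq,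
        bary_ne h' ha hs' hsr'.symm]; linarith
    · rw [bary_self h' ha, bary_ne h' ha hp' hsp', bary_ne h' ha hq' hsq',
        bary_ne h' ha hr' hsr']; linarith

/-- Two tetrahedra on the same side of a common face would overlap near its barycentre, and neither
sign is zero by nondegeneracy. -/
theorem side_eq_neg {K' : Finset E3} (h : IsTet K) (h' : IsTet K')
    (hdisj : Disjoint (interior (body K)) (interior (body K')))
    {p q r : E3} (hpq : p ≠ q) (hrp : r ≠ p) (hrq : r ≠ q)
    (hp : p ∈ K) (hq : q ∈ K) (hr : r ∈ K) (hp' : p ∈ K') (hq' : q ∈ K') (hr' : r ∈ K') :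
    side p q K r = -side p q K' r := by
  classical
  obtain ⟨s, hs, hsr, hsp, hsq, hK⟩ := exists_opposite_vertex h hp hq hr hpq hrp hrq
  obtain ⟨s', hs', hsr', hsp', hsq', hK'⟩ := exists_opposite_vertex h' hp' hq' hr' hpq hrp hrq
  have e : side p q K r = Real.sign (tri (q - p) (r - p) (s - p)) := by
    rw [hK, side_eq hpq hrp hrq hsr hsp hsq]
  have e' : side p q K' r = Real.sign (tri (q - p) (r - p) (s' - p)) := by
    rw [hK', side_eq hpq hrp hrq hsr' hsp' hsq']
  have hne := tri_ne_zero h hp hq hr hs hpq hrp hrq hsr hsp hsq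
  have hne' := tri_ne_zero h' hp' hq' hr' hs' hpq hrp hrq hsr' hsp' hsq'
  have hle : ¬ 0 < tri (q - p) (r - p) (s - p) * tri (q - p) (r - p) (s' - p) := by
    intro hpos
    have := inter_interior_nonempty_of_same_side h h' hpq hrp hrq hsr hsp hsq
      (fun x => by rw [hK]; simp) hsr' hsp' hsq' (fun x => by rw [hK']; simp) hpos
    exact (Set.disjoint_iff_inter_eq_empty.1 hdisj ▸ this).ne_empty rfl
  rw [e, e']
  rcases hne.lt_or_gt with h1 | h1 <;> rcases hne'.lt_or_gt with h2 | h2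
  · exact absurd (mul_pos_of_neg_of_neg h1 h2) hle
  · rw [Real.sign_of_neg h1, Real.sign_of_pos h2]
  · rw [Real.sign_of_pos h1, Real.sign_of_neg h2]; norm_num
  · exact absurd (mul_pos h1 h2) hle

/-! ### The edge basis functions on a tetrahedron -/

/-- The edge basis function of `[p, q]` on the tetrahedron `K`. -/
noncomputable def edgeLocal (K : Finset E3) (p q x : E3) : E3 :=
  bary K p x • bgrad K q - bary K q x • bgrad K p

/-- The curl of a linear vector field. -/
noncomputable def curlMap : (E3 →L[ℝ] E3) →ₗ[ℝ] E3 where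
  toFun A := !₂[A (EuclideanSpace.single 1 1) 2 - A (EuclideanSpace.single 2 1) 1,
    A (EuclideanSpace.single 2 1) 0 - A (EuclideanSpace.single 0 1) 2,
    A (EuclideanSpace.single 0 1) 1 - A (EuclideanSpace.single 1 1) 0]
  map_add' A B := by apply E3_ext <;> simp <;> ring
  map_smul' c A := by apply E3_ext <;> simp <;> ring

theorem curl_eq_curlMap {v : E3 → E3} {A : E3 →L[ℝ] E3} {x : E3} (h : HasFDerivAt v A x) :
    curl v x = curlMap A := by
  simp [curl, pd, h.fderiv, curlMap]

theorem curlMap_smulRight (a b : E3) : curlMap ((innerSL ℝ a).smulRight b) = cross a b := by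
  apply E3_ext <;> simp [curlMap, inner_eq_sum]

/-- The derivative of the edge basis function. -/
noncomputable def edgeDeriv (K : Finset E3) (p q : E3) : E3 →L[ℝ] E3 :=
  (innerSL ℝ (bgrad K p)).smulRight (bgrad K q) - (innerSL ℝ (bgrad K q)).smulRight (bgrad K p)

theorem hasFDerivAt_edgeLocal (h : IsTet K) {p q : E3} (hp : p ∈ K) (hq : q ∈ K) (x : E3) :
    HasFDerivAt (edgeLocal K p q) (edgeDeriv K p q) x :=
  ((hasFDerivAt_bary h hp x).smul_const (bgrad K q)).sub
    ((hasFDerivAt_bary h hq x).smul_const (bgrad K p))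

theorem curlMap_edgeDeriv (K : Finset E3) (p q : E3) :
    curlMap (edgeDeriv K p q) = (2 : ℝ) • cross (bgrad K p) (bgrad K q) := by
  rw [edgeDeriv, map_sub, curlMap_smulRight, curlMap_smulRight,
    cross_anticomm (bgrad K p) (bgrad K q), two_smul, sub_neg_eq_add]

/-- The component along `q - p` is the sum of the coordinates of `p` and `q`, positive in the
interior. Hence the support of a basis function contains every tetrahedron with its edge. -/
theorem edgeLocal_ne_zero (h : IsTet K) {p q x : E3} (hp : p ∈ K) (hq : q ∈ K) (hpq : p ≠ q)
    (hx : x ∈ interior (body K)) : edgeLocal K p q x ≠ 0 := by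
  intro h0
  have e : ⟪edgeLocal K p q x, q - p⟫ = bary K p x + bary K q x := by
    rw [edgeLocal, inner_sub_left, inner_smul_left, inner_smul_left, inner_bgrad h hq,
      inner_bgrad h hp, bary_self h hp, bary_self h hq, bary_ne h hp hq hpq,
      bary_ne h hq hp hpq.symm]
    simp
  rw [h0, inner_zero_left] at e
  rw [mem_interior_body_iff h] at hx
  linarith [hx p hp, hx q hq]

/-- An edge basis function is bounded by its curl. -/
theorem norm_edgeLocal_le (h : IsTet K) {ρ : ℝ} (hρ : shapeMeasure K ≤ ρ) {p q x : E3}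
    (hp : p ∈ K) (hq : q ∈ K) (hpq : p ≠ q) (hx : x ∈ body K) :
    ‖edgeLocal K p q x‖ ≤ (2 * ρ) ^ 2 * hK K * ‖curlMap (edgeDeriv K p q)‖ := by
  obtain ⟨t, ht, c, hc, hle⟩ := exists_closedBall_subset h hρ
  obtain ⟨r, s, hr, hs, hrs, hrp, hrq, hsp, hsq, -⟩ := exists_opposite_edge h hp hq hpq
  have hgp := mul_norm_bgrad_le h ht.le hc hp
  have hgq := mul_norm_bgrad_le h ht.le hc hq
  have hgr := mul_norm_bgrad_le h ht.le hc hr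
  have hx' := (mem_body_iff h).1 hx
  have h1 : t * ‖edgeLocal K p q x‖ ≤ 2 := by
    have : ‖edgeLocal K p q x‖ ≤ ‖bgrad K q‖ + ‖bgrad K p‖ := by
      rw [edgeLocal]
      refine (norm_sub_le _ _).trans (add_le_add ?_ ?_) <;>
        rw [norm_smul, Real.norm_eq_abs]
      · rw [abs_of_nonneg (hx' p hp)]
        exact mul_le_of_le_one_left (norm_nonneg _) (bary_le_one h hp hx)
      · rw [abs_of_nonneg (hx' q hq)]
        exact mul_le_of_le_one_left (norm_nonneg _) (bary_le_one h hq hx)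
    nlinarith
  -- Along the opposite edge the coordinate of `r` drops from 1 to 0, while its gradient has norm at
  -- most `1 / t`.
  have h2 : t ≤ ‖s - r‖ := by
    have e : ⟪bgrad K r, r - s⟫ = 1 := by
      rw [inner_bgrad h hr, bary_self h hr, bary_ne h hr hs hrs, sub_zero]
    have := real_inner_le_norm (bgrad K r) (r - s)
    rw [e, norm_sub_rev] at this
    nlinarith [norm_nonneg (s - r), norm_nonneg (bgrad K r)]
  have hmem : ∀ a ∈ K, ‖a - p‖ ≤ hK K := fun a ha => dist_le_hK (mem_body ha) (mem_body hp)
  have hpos := hK_pos h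
  have h3 : |tri (q - p) (r - p) (s - p)| ≤ hK K ^ 3 := by
    refine (abs_tri_le _ _ _).trans ?_
    have := hmem q hq
    have := hmem r hr
    have := hmem s hs
    calc ‖q - p‖ * ‖r - p‖ * ‖s - p‖ ≤ hK K * hK K * hK K := by gcongr
      _ = hK K ^ 3 := by ring
  -- This bounds the curl from below: triple product times cross product is the opposite edge
  -- vector, which has length at least `t`.
  have h4 : t ≤ hK K ^ 3 * ‖cross (bgrad K p) (bgrad K q)‖ := by
    rw [← tri_smul_cross_bgrad h hp hq hr hs hpq hrp hrq hrs.symm hsp hsq, norm_smul,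
      Real.norm_eq_abs] at h2
    exact h2.trans (mul_le_mul_of_nonneg_right h3 (norm_nonneg _))
  rw [curlMap_edgeDeriv, norm_smul, Real.norm_ofNat]
  set N := ‖cross (bgrad K p) (bgrad K q)‖
  set d := hK K
  have hd : d ^ 2 ≤ (2 * ρ * t) ^ 2 := pow_le_pow_left₀ hpos.le hle 2
  have hN : 0 ≤ N := norm_nonneg _
  have h5 : t ^ 2 * ‖edgeLocal K p q x‖ ≤ t ^ 2 * ((2 * ρ) ^ 2 * d * (2 * N)) := by
    calc t ^ 2 * ‖edgeLocal K p q x‖ = t * (t * ‖edgeLocal K p q x‖) := by ring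
      _ ≤ t * 2 := by gcongr
      _ ≤ d ^ 3 * N * 2 := by gcongr
      _ = d ^ 2 * (2 * d * N) := by ring
      _ ≤ (2 * ρ * t) ^ 2 * (2 * d * N) := by gcongr
      _ = t ^ 2 * ((2 * ρ) ^ 2 * d * (2 * N)) := by ring
  exact le_of_mul_le_mul_left h5 (by positivity)

end EdgeMG

namespace EdgeMG

/-! ### Meshes -/

variable {Ω ΓD : Set E3} {M T : Mesh}

theorem IsMesh.eq_of_inter (hT : IsMesh Ω ΓD T) {K K' : Finset E3} (hK : K ∈ T) (hK' : K' ∈ T)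
    {x : E3} (hx : x ∈ interior (body K)) (hx' : x ∈ body K') : K = K' := by
  by_contra hne
  obtain ⟨y, hy, hy'⟩ := inter_interior_nonempty (hT.isTet K' hK') isOpen_interior hx hx'
  exact Set.disjoint_left.1 (hT.disjoint K hK K' hK' hne) hy hy'

theorem IsMesh.eq_of_body_subset (hT : IsMesh Ω ΓD T) {K K₁ K₂ : Finset E3} (hK : IsTet K)
    (hK₁ : K₁ ∈ T) (hK₂ : K₂ ∈ T) (h₁ : body K ⊆ body K₁) (h₂ : body K ⊆ body K₂) : K₁ = K₂ := by
  obtain ⟨x, hx⟩ := interior_body_nonempty hK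
  exact hT.eq_of_inter hK₁ hK₂ (interior_mono h₁ hx) (h₂ (_root_.interior_subset hx))

theorem IsMesh.exists_mem_body (hT : IsMesh Ω ΓD T) {x : E3} (hx : x ∈ closure Ω) :
    ∃ K ∈ T, x ∈ body K := by
  rw [← hT.cover] at hx
  simpa using hx

theorem IsMesh.body_subset (hT : IsMesh Ω ΓD T) {K : Finset E3} (hK : K ∈ T) :
    body K ⊆ closure Ω := by
  rw [← hT.cover]
  exact Set.subset_biUnion_of_mem (u := fun K => body K) hK

theorem Nested.exists_mem_body (h : Nested M T) {K : Finset E3} (hK : K ∈ M) {x : E3}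
    (hx : x ∈ body K) : ∃ K' ∈ T, body K' ⊆ body K ∧ x ∈ body K' := by
  rw [h K hK] at hx
  simp only [Set.mem_ofPred_eq, Set.mem_iUnion] at hx
  obtain ⟨K', ⟨h1, h2⟩, h3⟩ := hx
  exact ⟨K', h1, h2, h3⟩

/-- In a nested pair of meshes, each element of the fine mesh is contained in an element of the
coarse one, and each element of the coarse mesh contains an element of the fine one. -/
structure Refines (M T : Mesh) : Prop where
  parent : ∀ K' ∈ T, ∃ K ∈ M, body K' ⊆ body K
  child : ∀ K ∈ M, ∃ K' ∈ T, body K' ⊆ body K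

/-- An interior point of `K'` lies in some coarse element, which is a union of fine elements; the
fine element of this union containing the point can only be `K'`. -/
theorem Nested.refines (h : Nested M T) (hM : IsMesh Ω ΓD M) (hT : IsMesh Ω ΓD T) :
    Refines M T where
  parent K' hK' := by
    obtain ⟨x, hx⟩ := interior_body_nonempty (hT.isTet K' hK')
    obtain ⟨K, hK, hxK⟩ := hM.exists_mem_body (hT.body_subset hK' (_root_.interior_subset hx))
    obtain ⟨K'', h1, h2, h3⟩ := h.exists_mem_body hK hxK
    rw [← hT.eq_of_inter hK' h1 hx h3] at h2
    exact ⟨K, hK, h2⟩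
  child K hK := by
    obtain ⟨x, hx⟩ := body_nonempty (hM.isTet K hK)
    obtain ⟨K', h1, h2, -⟩ := h.exists_mem_body hK hx
    exact ⟨K', h1, h2⟩

theorem Refines.refl (M : Mesh) : Refines M M :=
  ⟨fun K hK => ⟨K, hK, le_rfl⟩, fun K hK => ⟨K, hK, le_rfl⟩⟩

theorem Refines.trans {M' : Mesh} (h : Refines M T) (h' : Refines T M') : Refines M M' where
  parent K hK := by
    obtain ⟨K₁, h1, h2⟩ := h'.parent K hK
    obtain ⟨K₂, h3, h4⟩ := h.parent K₁ h1
    exact ⟨K₂, h3, h2.trans h4⟩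
  child K hK := by
    obtain ⟨K₁, h1, h2⟩ := h.child K hK
    obtain ⟨K₂, h3, h4⟩ := h'.child K₁ h1
    exact ⟨K₂, h3, h4.trans h2⟩

theorem refines_of_nested {S : ℕ → Mesh} {L : ℕ} (hS : ∀ l ≤ L, IsMesh Ω ΓD (S l))
    (hn : ∀ l < L, Nested (S l) (S (l + 1))) {m l : ℕ} (hml : m ≤ l) (hl : l ≤ L) :
    Refines (S m) (S l) := by
  induction l, hml using Nat.le_induction with
  | base => exact Refines.refl _
  | succ l hml ih =>
    exact (ih (by omega)).trans ((hn l (by omega)).refines (hS l (by omega)) (hS _ hl))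

/-- This confines the tetrahedra around an edge to the coarse element whose interior the edge meets.
-/
theorem Refines.body_subset_of_inter (h : Refines M T) (hM : IsMesh Ω ΓD M)
    {K K' : Finset E3} (hK : K ∈ M) (hK' : K' ∈ T) {x : E3} (hx : x ∈ interior (body K))
    (hx' : x ∈ body K') : body K' ⊆ body K := by
  obtain ⟨K₁, h1, h2⟩ := h.parent K' hK'
  rwa [hM.eq_of_inter hK h1 hx (h2 hx')]

/-! ### Integration on meshes -/

theorem IsMesh.ae_eq (hT : IsMesh Ω ΓD T) : (⋃ K ∈ T, interior (body K)) =ᵐ[volume] Ω := by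
  have h1 : (⋃ K ∈ T, interior (body K)) ⊆ Ω := Set.iUnion₂_subset hT.interior_subset
  have h2 : Ω ⊆ ⋃ K ∈ T, body K := subset_closure.trans hT.cover.ge
  refine (LE.le.eventuallyLE h1).antisymm ?_
  refine (LE.le.eventuallyLE h2).trans ?_
  refine Filter.EventuallyEq.le ?_
  exact Filter.EventuallyEq.symm
    (Finset.eventuallyEq_iUnion (s := T) fun K _ => interior_body_ae_eq K)

theorem IsMesh.restrict_eq (hT : IsMesh Ω ΓD T) :
    volume.restrict Ω = volume.restrict (⋃ K ∈ T, interior (body K)) :=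
  (Measure.restrict_congr_set hT.ae_eq).symm

theorem IsMesh.ae_mem_interior (hT : IsMesh Ω ΓD T) :
    ∀ᵐ x ∂volume.restrict Ω, ∃ K ∈ T, x ∈ interior (body K) := by
  rw [hT.restrict_eq]
  filter_upwards [ae_restrict_mem (T.measurableSet_biUnion
    fun K _ => isOpen_interior.measurableSet)] with x hx
  simpa using hx

theorem IsMesh.integral_eq (hT : IsMesh Ω ΓD T) {f : E3 → ℝ} {c : Finset E3 → ℝ}
    (hf : ∀ K ∈ T, ∀ x ∈ interior (body K), f x = c K) :
    ∫ x in Ω, f x = ∑ K ∈ T, volume.real (body K) * c K := by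
  have hfin : ∀ K : Finset E3, volume (interior (body K)) ≠ ⊤ := fun K => by
    rw [volume_interior_body]; exact volume_body_ne_top K
  rw [hT.restrict_eq, integral_biUnion_finset]
  · refine Finset.sum_congr rfl fun K hK => ?_
    rw [setIntegral_congr_fun isOpen_interior.measurableSet (hf K hK), setIntegral_const,
      measureReal_def, volume_interior_body, smul_eq_mul, measureReal_def]
  · exact fun K _ => isOpen_interior.measurableSet
  · exact fun K hK K' hK' hne => hT.disjoint K hK K' hK' hne
  · intro K hK
    rw [integrableOn_congr_fun (hf K hK) isOpen_interior.measurableSet]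
    exact integrableOn_const (hfin K)

theorem IsMesh.memLp (hT : IsMesh Ω ΓD T) {f : E3 → E3}
    (hf : ∀ K ∈ T, ∃ g : E3 → E3, Continuous g ∧ ∀ x ∈ interior (body K), f x = g x) :
    MemLp f 2 (volume.restrict Ω) := by
  have key : ∀ K ∈ T, AEStronglyMeasurable f (volume.restrict (interior (body K))) ∧
      IntegrableOn (fun x => ‖f x‖ ^ 2) (interior (body K)) := by
    intro K hK
    obtain ⟨g, hg, hfg⟩ := hf K hK
    have hfg' : Set.EqOn (fun x => ‖f x‖ ^ 2) (fun x => ‖g x‖ ^ 2) (interior (body K)) :=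
      fun x hx => by simp only [hfg x hx]
    constructor
    · refine hg.aestronglyMeasurable.congr ?_
      filter_upwards [ae_restrict_mem isOpen_interior.measurableSet] with x hx
      exact (hfg x hx).symm
    · rw [integrableOn_congr_fun hfg' isOpen_interior.measurableSet]
      exact ((by fun_prop : Continuous fun x => ‖g x‖ ^ 2).continuousOn.integrableOn_compact
        (isCompact_body K)).mono_set _root_.interior_subset
  rw [hT.restrict_eq]
  rw [memLp_two_iff_integrable_sq_norm]
  · exact (integrableOn_finset_iUnion (s := T)).2 fun K hK => (key K hK).2
  · have e : (⋃ K ∈ T, interior (body K)) = ⋃ K : T, interior (body K.1) := by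
      rw [Set.iUnion_subtype]
    rw [e, aestronglyMeasurable_iUnion_iff]
    exact fun K => (key K.1 K.2).1

theorem abs_innerL2_le {f g : E3 → E3} (hf : MemLp f 2 (volume.restrict Ω))
    (hg : MemLp g 2 (volume.restrict Ω)) :
    |innerL2 Ω f g| ≤ normL2 Ω f * normL2 Ω g := by
  have e1 : innerL2 Ω f g = ⟪hf.toLp f, hg.toLp g⟫ := by
    rw [L2.inner_def, innerL2]
    refine integral_congr_ae ?_
    filter_upwards [hf.coeFn_toLp, hg.coeFn_toLp] with x h1 h2
    rw [h1, h2]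
  have e2 : ∀ {f : E3 → E3} (hf : MemLp f 2 (volume.restrict Ω)), normL2 Ω f = ‖hf.toLp f‖ := by
    intro f hf
    rw [← Real.sqrt_sq (norm_nonneg (hf.toLp f)), ← real_inner_self_eq_norm_sq, L2.inner_def,
      normL2]
    congr 1
    refine integral_congr_ae ?_
    filter_upwards [hf.coeFn_toLp] with x h1
    rw [h1, real_inner_self_eq_norm_sq]
  rw [e1, e2 hf, e2 hg]
  exact abs_real_inner_le_norm _ _

theorem normL2_le_mul {f g : E3 → E3} {c : ℝ} (hc : 0 ≤ c)
    (hg : MemLp g 2 (volume.restrict Ω))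
    (h : ∀ᵐ x ∂volume.restrict Ω, ‖f x‖ ≤ c * ‖g x‖) : normL2 Ω f ≤ c * normL2 Ω g := by
  rw [normL2, normL2, ← Real.sqrt_sq hc, ← Real.sqrt_mul (sq_nonneg c), ← integral_const_mul]
  apply Real.sqrt_le_sqrt
  refine integral_mono_of_nonneg (Filter.Eventually.of_forall fun x => by positivity)
    (hg.integrable_norm_pow (by norm_num) |>.const_mul _) ?_
  filter_upwards [h] with x hx
  rw [← mul_pow]
  exact pow_le_pow_left₀ (norm_nonneg _) hx 2

theorem IsMesh.normL2_sq (hT : IsMesh Ω ΓD T) {f : E3 → E3} {c : Finset E3 → E3}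
    (hf : ∀ K ∈ T, ∀ x ∈ interior (body K), f x = c K) :
    normL2 Ω f = √(∑ K ∈ T, volume.real (body K) * ‖c K‖ ^ 2) := by
  rw [normL2, hT.integral_eq (c := fun K => ‖c K‖ ^ 2) fun K hK x hx => by rw [hf K hK x hx]]

/-! ### Mesh width -/

theorem hK_le_meshWidth {K : Finset E3} (h : K ∈ T) : hK K ≤ meshWidth T :=
  le_csSup ((T.finite_toSet.image _).bddAbove) ⟨K, h, rfl⟩

theorem exists_hK_eq_meshWidth (hT : T.Nonempty) : ∃ K ∈ T, hK K = meshWidth T :=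
  Set.Nonempty.csSup_mem ((Finset.coe_nonempty.2 hT).image hK) (T.finite_toSet.image _)

theorem meshWidth_nonneg (T : Mesh) : 0 ≤ meshWidth T :=
  Real.sSup_nonneg (by rintro _ ⟨K, -, rfl⟩; exact hK_nonneg K)

/-! ### Edges in the interior of the domain -/

-- The point `z` keeps the face off the boundary of `Ω`, so conformity supplies a second
-- tetrahedron. Any two tetrahedra at the face have opposite sides, which leaves no room for a
-- third.
open Classical in
theorem sum_side_eq_zero (hΩ : IsOpen Ω) (hT : IsMesh Ω ΓD T) (hc : Conforming Ω T) {p q r z : E3}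
    (hpq : p ≠ q) (hrp : r ≠ p) (hrq : r ≠ q) (hz : z ∈ segment ℝ p q) (hzΩ : z ∈ Ω) :
    ∑ K ∈ T with p ∈ K ∧ q ∈ K ∧ r ∈ K, side p q K r = 0 := by
  set S := T.filter (fun K => p ∈ K ∧ q ∈ K ∧ r ∈ K) with hS
  have hmem : ∀ K, K ∈ S ↔ K ∈ T ∧ p ∈ K ∧ q ∈ K ∧ r ∈ K := fun K => by simp [hS]
  rcases S.eq_empty_or_nonempty with hemp | ⟨K₁, hK₁⟩
  · rw [hemp, Finset.sum_empty]
  have hopp : ∀ K ∈ S, ∀ K' ∈ S, K ≠ K' → side p q K r = -side p q K' r := by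
    intro K hK K' hK' hne
    obtain ⟨h1, h2, h3, h4⟩ := (hmem K).1 hK
    obtain ⟨h1', h2', h3', h4'⟩ := (hmem K').1 hK'
    exact side_eq_neg (hT.isTet K h1) (hT.isTet K' h1') (hT.disjoint K h1 K' h1' hne) hpq hrp hrq
      h2 h3 h4 h2' h3' h4'
  obtain ⟨h1, h2, h3, h4⟩ := (hmem K₁).1 hK₁
  have hF : ({p, q, r} : Finset E3) ⊆ K₁ := by
    intro x hx
    simp only [Finset.mem_insert, Finset.mem_singleton] at hx
    rcases hx with rfl | rfl | rfl <;> assumption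
  have hcard : ({p, q, r} : Finset E3).card = 3 := Finset.card_eq_three.2
    ⟨p, q, r, hpq, hrp.symm, hrq.symm, rfl⟩
  have hnot : ¬ body {p, q, r} ⊆ frontier Ω := by
    intro hsub
    have hzb : z ∈ body {p, q, r} :=
      (convex_body _).segment_subset (mem_body (by simp)) (mem_body (by simp)) hz
    exact (hsub hzb).2 (by rwa [hΩ.interior_eq])
  obtain ⟨K₂, hK₂T, hne, hF₂⟩ := (hc K₁ h1 _ hF hcard).resolve_left hnot
  have hK₂ : K₂ ∈ S := (hmem K₂).2 ⟨hK₂T, hF₂ (by simp), hF₂ (by simp), hF₂ (by simp)⟩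
  -- The value is in fact never zero, but this case follows from `hopp` alone.
  by_cases hzero : side p q K₁ r = 0
  · refine Finset.sum_eq_zero fun K hK => ?_
    by_cases hKe : K = K₁
    · rw [hKe, hzero]
    · rw [hopp K hK K₁ hK₁ hKe, hzero, neg_zero]
  have hSe : S = {K₁, K₂} := by
    apply Finset.Subset.antisymm
    · intro K hK
      by_contra hcon
      simp only [Finset.mem_insert, Finset.mem_singleton, not_or] at hcon
      have e1 := hopp K hK K₁ hK₁ hcon.1
      have e2 := hopp K hK K₂ hK₂ hcon.2
      have e3 := hopp K₂ hK₂ K₁ hK₁ hne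
      exact hzero (by linarith)
    · intro K hK
      simp only [Finset.mem_insert, Finset.mem_singleton] at hK
      rcases hK with rfl | rfl <;> assumption
  rw [hSe, Finset.sum_pair hne.symm, hopp K₁ hK₁ K₂ hK₂ hne.symm]
  ring

open Classical in
/-- The integral of the curl of an edge basis function attached to an edge that meets the domain
vanishes. -/
theorem sum_volume_smul_cross_eq_zero (hΩ : IsOpen Ω) (hT : IsMesh Ω ΓD T)
    (hc : Conforming Ω T) {p q z : E3}
    (hpq : p ≠ q) (hz : z ∈ segment ℝ p q) (hzΩ : z ∈ Ω) :
    ∑ K ∈ T with p ∈ K ∧ q ∈ K, volume.real (body K) • cross (bgrad K p) (bgrad K q) = 0 := by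
  have h1 : ∀ K ∈ T.filter (fun K => p ∈ K ∧ q ∈ K),
      volume.real (body K) • cross (bgrad K p) (bgrad K q) =
        -(refVolume • ∑ r ∈ K, side p q K r • r) := by
    intro K hK
    rw [Finset.mem_filter] at hK
    exact volume_smul_cross_bgrad (hT.isTet K hK.1) hK.2.1 hK.2.2 hpq
  -- Exchanging the sums collects the terms by vertex: the coefficient of `r` is the sum of the
  -- sides over all tetrahedra at the face `p`, `q`, `r`.
  rw [Finset.sum_congr rfl h1, Finset.sum_neg_distrib, ← Finset.smul_sum,
    Finset.sum_comm' (t' := T.biUnion id)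
      (s' := fun r => T.filter (fun K => p ∈ K ∧ q ∈ K ∧ r ∈ K))]
  · rw [Finset.sum_eq_zero, smul_zero, neg_zero]
    intro r _
    rw [← Finset.sum_smul]
    by_cases hrp : r = p
    · subst hrp; simp [side_left]
    by_cases hrq : r = q
    · subst hrq; simp [side_right]
    rw [sum_side_eq_zero hΩ hT hc hpq hrp hrq hz hzΩ, zero_smul]
  · intro K r
    simp only [Finset.mem_filter, Finset.mem_biUnion, id]
    constructor
    · rintro ⟨⟨h1, h2, h3⟩, h4⟩
      exact ⟨⟨h1, h2, h3, h4⟩, K, h1, h4⟩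
    · rintro ⟨⟨h1, h2, h3, h4⟩, -⟩
      exact ⟨⟨h1, h2, h3⟩, h4⟩

/-! ### The nodal basis functions -/

theorem edgeBasis_eq (hT : IsMesh Ω ΓD T) {K : Finset E3} (hK : K ∈ T) {p q x : E3}
    (hp : p ∈ K) (hq : q ∈ K) (hx : x ∈ interior (body K)) :
    edgeBasis T p q x = edgeLocal K p q x := by
  rw [edgeBasis, Finset.sum_eq_single K]
  · rw [Set.indicator_of_mem (by exact ⟨hp, hq, hx⟩), gradient_bary (hT.isTet K hK) hp,
      gradient_bary (hT.isTet K hK) hq, edgeLocal]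
  · intro K' hK' hne
    rw [Set.indicator_of_notMem]
    rintro ⟨-, -, hx'⟩
    exact hne (hT.eq_of_inter hK hK' hx (_root_.interior_subset hx')).symm
  · exact fun h => absurd hK h

theorem edgeBasis_eq_zero (hT : IsMesh Ω ΓD T) {K : Finset E3} (hK : K ∈ T) {p q x : E3}
    (hpq : ¬ (p ∈ K ∧ q ∈ K)) (hx : x ∈ interior (body K)) : edgeBasis T p q x = 0 := by
  rw [edgeBasis]
  refine Finset.sum_eq_zero fun K' hK' => ?_
  rw [Set.indicator_of_notMem]
  rintro ⟨hp, hq, hx'⟩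
  rw [← hT.eq_of_inter hK hK' hx (_root_.interior_subset hx')] at hp hq
  exact hpq ⟨hp, hq⟩

theorem body_subset_tsupport (hT : IsMesh Ω ΓD T) {K : Finset E3} (hK : K ∈ T) {p q : E3}
    (hp : p ∈ K) (hq : q ∈ K) (hpq : p ≠ q) : body K ⊆ tsupport (edgeBasis T p q) := by
  rw [← closure_interior_body (hT.isTet K hK)]
  refine closure_mono fun x hx => ?_
  rw [Function.mem_support, edgeBasis_eq hT hK hp hq hx]
  exact edgeLocal_ne_zero (hT.isTet K hK) hp hq hpq hx

/-! ### The refinement zone -/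

variable {L : ℕ} {S That : ℕ → Mesh}

/-- An element new in mesh `j + 1` has a parent in mesh `j` that does not survive, for otherwise the
two would coincide. By `refines` the parent has level `j`, and the induction continues from it. -/
theorem IsRefinementHierarchy.exists_ancestor (hS : IsRefinementHierarchy Ω ΓD L S) {l j : ℕ}
    (hlj : l ≤ j) (hj : j ≤ L) :
    ∀ K ∈ S j, level S K = j → ∃ K' ∈ S l, level S K' = l ∧ body K ⊆ body K' := by
  induction j, hlj using Nat.le_induction with
  | base => exact fun K hK hlev => ⟨K, hK, hlev, le_rfl⟩
  | succ j hlj ih =>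
    intro K hK hlev
    have hKj : K ∉ S j := by
      intro h
      have : level S K ≤ j := Nat.sInf_le h
      omega
    have href := (hS.nested j (by omega)).refines (hS.isMesh j (by omega)) (hS.isMesh _ hj)
    obtain ⟨K₁, hK₁, hsub⟩ := href.parent K hK
    have hK₁j : K₁ ∉ S (j + 1) := by
      intro h
      have htet := (hS.isMesh _ hj).isTet K hK
      exact hKj ((hS.isMesh _ hj).eq_of_body_subset htet hK h le_rfl hsub ▸ hK₁)
    obtain ⟨K', h1, h2, h3⟩ := ih (by omega) K₁ hK₁ (hS.refines j (by omega) K₁ hK₁ hK₁j)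
    exact ⟨K', h1, h2, hsub.trans h3⟩

/-- The elements of the companion mesh inside the refinement zone belong to the mesh itself. -/
theorem mem_of_body_subset_zone (hS : IsRefinementHierarchy Ω ΓD L S)
    (hC : IsCompanion Ω ΓD L S That) {l : ℕ} (hl : l ≤ L) {K : Finset E3} (hK : K ∈ That l)
    (hsub : body K ⊆ closure (zone L S l)) : K ∈ S l := by
  have hclosed : IsClosed (⋃ K ∈ {K | K ∈ S L ∧ l ≤ level S K}, body K) := by
    refine Set.Finite.isClosed_biUnion ?_ fun K _ => isClosed_body K
    exact (S L).finite_toSet.subset fun K hK => hK.1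
  have hcl : closure (zone L S l) ⊆ ⋃ K ∈ {K | K ∈ S L ∧ l ≤ level S K}, body K :=
    closure_minimal _root_.interior_subset hclosed
  obtain ⟨x, hx⟩ := interior_body_nonempty ((hC.isMesh l hl).isTet K hK)
  have hx' := hcl (hsub (_root_.interior_subset hx))
  simp only [Set.mem_iUnion, Set.mem_ofPred_eq] at hx'
  obtain ⟨K₁, ⟨h1, h2⟩, h3⟩ := hx'
  have hlev : level S K₁ ≤ L := Nat.sInf_le h1
  have hmem : K₁ ∈ S (level S K₁) := Nat.sInf_mem (s := {k | K₁ ∈ S k}) ⟨L, h1⟩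
  obtain ⟨K', h4, h5, h6⟩ := hS.exists_ancestor h2 hlev K₁ hmem rfl
  -- The ancestor `K'` of level `l` belongs to `That l` by `top_level` and shares an interior point
  -- with `K`, so the two are equal.
  rwa [(hC.isMesh l hl).eq_of_inter hK (hC.top_level l hl K' h4 h5) hx (h6 h3)]

end EdgeMG

namespace EdgeMG

variable {Ω ΓD : Set E3} {M T : Mesh}

/-! ### Fields of the form `a + b × x` -/

/-- The linear field `x ↦ b × x`. -/
noncomputable def crossCLM (b : E3) : E3 →L[ℝ] E3 :=
  LinearMap.toContinuousLinearMap
    { toFun := cross b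
      map_add' := fun x y => by apply E3_ext <;> simp <;> ring
      map_smul' := fun c x => by apply E3_ext <;> simp <;> ring }

/-- The field is of the form `a + b × x` on each element of the mesh. -/
def IsLocallyWhitney (T : Mesh) (v : E3 → E3) : Prop :=
  ∀ K ∈ T, ∃ a b : E3, ∀ x ∈ interior (body K), v x = a + cross b x

/-- The elementwise form is all that the estimates need of the coarse space; hence the weights of
the slave edges are immaterial. -/
theorem IsEdgeSpace.isLocallyWhitney {U : Set (E3 → E3)} (hU : IsEdgeSpace Ω ΓD T U)
    {v : E3 → E3} (hv : v ∈ U) : IsLocallyWhitney T v := by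
  rcases hU with rfl | ⟨b, w, hb, rfl⟩
  · exact hv.2
  · intro K hK
    refine Submodule.span_induction (p := fun v _ => ∃ a b : E3, ∀ x ∈ interior (body K),
      v x = a + cross b x) ?_ ?_ ?_ ?_ hv
    · rintro _ ⟨p, q, hpq, rfl⟩
      obtain ⟨a, c, h, -⟩ := hb.isLocal p q hpq K hK
      exact ⟨a, c, h⟩
    · exact ⟨0, 0, fun x _ => by apply E3_ext <;> simp⟩
    · rintro f g - - ⟨a, c, h⟩ ⟨a', c', h'⟩
      refine ⟨a + a', c + c', fun x hx => ?_⟩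
      rw [Pi.add_apply, h x hx, h' x hx]
      apply E3_ext <;> simp <;> ring
    · rintro t f - ⟨a, c, h⟩
      refine ⟨t • a, t • c, fun x hx => ?_⟩
      rw [Pi.smul_apply, h x hx]
      apply E3_ext <;> simp <;> ring

theorem IsLocallyWhitney.exists_curl {v : E3 → E3} (hv : IsLocallyWhitney T v) :
    ∃ B : Finset E3 → E3, ∀ K ∈ T, ∀ x ∈ interior (body K), curl v x = B K := by
  have : ∀ K, ∃ B : E3, K ∈ T → ∀ x ∈ interior (body K), curl v x = B := by
    intro K
    by_cases hK : K ∈ T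
    · obtain ⟨a, b, h⟩ := hv K hK
      refine ⟨curlMap (crossCLM b), fun _ x hx => curl_eq_curlMap ?_⟩
      have h1 : HasFDerivAt (fun x => a + crossCLM b x) (crossCLM b) x :=
        (crossCLM b).hasFDerivAt.const_add a
      refine h1.congr_of_eventuallyEq ?_
      filter_upwards [isOpen_interior.mem_nhds hx] with y hy
      exact h y hy
    · exact ⟨0, fun h => absurd h hK⟩
  choose B hB using this
  exact ⟨B, hB⟩

theorem IsLocallyWhitney.memLp {v : E3 → E3} (hv : IsLocallyWhitney T v) (hT : IsMesh Ω ΓD T) :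
    MemLp v 2 (volume.restrict Ω) := by
  refine hT.memLp fun K hK => ?_
  obtain ⟨a, b, h⟩ := hv K hK
  exact ⟨fun x => a + crossCLM b x, by fun_prop, h⟩

/-! ### Fields spanned by the basis functions of one class -/

/-- The element `K'` has an edge of the class `A` that does not meet the interior of `K`. -/
def HasOuterEdge (A : Set (Finset E3)) (K K' : Finset E3) : Prop :=
  ∃ E ∈ A, E ⊆ K' ∧ Disjoint (body E) (interior (body K))

open Classical in
/-- The properties of a linear combination `u` of basis functions attached to the edges in `A`, with
derivative `D K` on each element `K`. -/
structure IsClassField (M T : Mesh) (A : Set (Finset E3)) (u : E3 → E3)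
    (D : Finset E3 → E3 →L[ℝ] E3) : Prop where
  hasFDerivAt : ∀ K ∈ T, ∀ x ∈ interior (body K), HasFDerivAt u (D K) x
  eq_zero : ∀ K ∈ T, (∀ E ∈ A, ¬ E ⊆ K) → ∀ x ∈ interior (body K), u x = 0
  eq_smul : ∀ K ∈ T, ∀ p ∈ K, ∀ q ∈ K, p ≠ q → {p, q} ∈ A →
    ∃ a : ℝ, D K = a • edgeDeriv K p q ∧ ∀ x ∈ interior (body K), u x = a • edgeLocal K p q x
  cancel : ∀ K ∈ M, ∑ K' ∈ T with body K' ⊆ body K ∧ ¬ HasOuterEdge A K K',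
    volume.real (body K') • curlMap (D K') = 0

open Classical in
theorem pair_eq_pair_iff {p q p' q' : E3} (h : ({p, q} : Finset E3) = {p', q'}) :
    p = p' ∧ q = q' ∨ p = q' ∧ q = p' := by
  have h' : ({p, q} : Set E3) = {p', q'} := by
    have := congrArg (fun s : Finset E3 => (s : Set E3)) h
    simpa using this
  exact Set.pair_eq_pair_iff.1 h'

open Classical in
theorem pair_subset {p q : E3} {K : Finset E3} (h : p ∈ K ∧ q ∈ K) :
    ({p, q} : Finset E3) ⊆ K := by
  rw [Finset.insert_subset_iff, Finset.singleton_subset_iff]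
  exact h

theorem edgeDeriv_swap (K : Finset E3) (p q : E3) : edgeDeriv K q p = -edgeDeriv K p q := by
  rw [edgeDeriv, edgeDeriv, neg_sub]

theorem edgeLocal_swap (K : Finset E3) (p q x : E3) : edgeLocal K q p x = -edgeLocal K p q x := by
  rw [edgeLocal, edgeLocal, neg_sub]

-- By separation, an element with an edge in `A` either has that edge equal to `[p, q]` up to
-- orientation, with factor `1` or `-1`, or carries no part of this basis function, with factor `0`.
open Classical in
theorem isClassField_edgeBasis (hΩ : IsOpen Ω) (hM : IsMesh Ω ΓD M) (hT : IsMesh Ω ΓD T)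
    (hMT : Refines M T) (hc : Conforming Ω T) {A : Set (Finset E3)}
    (hsep : ∀ K ∈ T, ∀ E ∈ A, ∀ E' ∈ A, E ⊆ K → E' ⊆ K → E = E')
    {p q : E3} (hpq : p ≠ q) (hA : {p, q} ∈ A) :
    IsClassField M T A (edgeBasis T p q)
      (fun K => if p ∈ K ∧ q ∈ K then edgeDeriv K p q else 0) where
  hasFDerivAt K hK x hx := by
    split_ifs with h
    · refine (hasFDerivAt_edgeLocal (hT.isTet K hK) h.1 h.2 x).congr_of_eventuallyEq ?_
      filter_upwards [isOpen_interior.mem_nhds hx] with y hy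
      exact edgeBasis_eq hT hK h.1 h.2 hy
    · refine (hasFDerivAt_const (0 : E3) x).congr_of_eventuallyEq ?_
      filter_upwards [isOpen_interior.mem_nhds hx] with y hy
      exact edgeBasis_eq_zero hT hK h hy
  eq_zero K hK h x hx :=
    edgeBasis_eq_zero hT hK (fun hpq' => h _ hA (pair_subset hpq')) hx
  eq_smul K hK p' hp' q' hq' hpq' hA' := by
    by_cases h : p ∈ K ∧ q ∈ K
    · have heq := hsep K hK _ hA _ hA' (pair_subset h) (pair_subset ⟨hp', hq'⟩)
      rcases pair_eq_pair_iff heq with ⟨rfl, rfl⟩ | ⟨rfl, rfl⟩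
      · refine ⟨1, by rw [if_pos h, one_smul], fun x hx => ?_⟩
        rw [edgeBasis_eq hT hK h.1 h.2 hx, one_smul]
      · refine ⟨-1, ?_, fun x hx => ?_⟩
        · rw [if_pos h, edgeDeriv_swap]
          exact (neg_one_smul ℝ (edgeDeriv K q p)).symm
        · rw [edgeBasis_eq hT hK h.1 h.2 hx, edgeLocal_swap, neg_one_smul]
    · refine ⟨0, by rw [if_neg h]; exact (zero_smul ℝ (edgeDeriv K p' q')).symm, fun x hx => ?_⟩
      rw [edgeBasis_eq_zero hT hK h hx, zero_smul]
  cancel K hK := by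
    have hseg : body {p, q} = segment ℝ p q := by
      rw [body, ← convexHull_pair]
      simp
    -- If the edge misses the interior of `K`, every tetrahedron carrying it is outer and is
    -- excluded from the sum.
    by_cases hdisj : Disjoint (body {p, q}) (interior (body K))
    · refine Finset.sum_eq_zero fun K' hK' => ?_
      rw [Finset.mem_filter] at hK'
      rw [if_neg, map_zero, smul_zero]
      exact fun h => hK'.2.2 ⟨_, hA, pair_subset h, hdisj⟩
    · obtain ⟨z, hz, hzK⟩ := Set.not_disjoint_iff.1 hdisj
      rw [hseg] at hz
      have key := sum_volume_smul_cross_eq_zero hΩ hT hc hpq hz (hM.interior_subset K hK hzK)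
      -- Otherwise all tetrahedra at the edge lie in `K`, and none is outer because `{p, q}` is its
      -- only edge in `A`. The sum then runs over the complete patch; the factor 2 is that of
      -- `curlMap_edgeDeriv`.
      refine Eq.trans ?_ ((congrArg ((2 : ℝ) • ·) key).trans (smul_zero _))
      rw [Finset.smul_sum, Finset.sum_filter, Finset.sum_filter]
      refine Finset.sum_congr rfl fun K' hK' => ?_
      by_cases h : p ∈ K' ∧ q ∈ K'
      · rw [if_pos h, if_pos h, curlMap_edgeDeriv, smul_comm, if_pos]
        refine ⟨hMT.body_subset_of_inter hM hK hK' hzK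
          ((convex_body K').segment_subset (mem_body h.1) (mem_body h.2) hz), ?_⟩
        rintro ⟨E, hE, hEK', hEd⟩
        rw [← hsep K' hK' _ hA _ hE (pair_subset h) hEK'] at hEd
        exact hdisj hEd
      · rw [if_neg h, if_neg h, map_zero, smul_zero, ite_self]

theorem IsClassField.zero {A : Set (Finset E3)} : IsClassField M T A 0 0 where
  hasFDerivAt _ _ x _ := hasFDerivAt_const (0 : E3) x
  eq_zero _ _ _ _ _ := rfl
  eq_smul K _ p _ q _ _ _ := ⟨0, (zero_smul ℝ (edgeDeriv K p q)).symm, fun _ _ => (zero_smul ℝ _).symm⟩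
  cancel _ _ := by simp

/-- The elements summed over in `cancel` depend on `A` and not on the field, so the property passes
to linear combinations. -/
theorem IsClassField.add {A : Set (Finset E3)} {u u' : E3 → E3} {D D' : Finset E3 → E3 →L[ℝ] E3}
    (h : IsClassField M T A u D) (h' : IsClassField M T A u' D') :
    IsClassField M T A (u + u') (D + D') where
  hasFDerivAt K hK x hx := (h.hasFDerivAt K hK x hx).add (h'.hasFDerivAt K hK x hx)
  eq_zero K hK hE x hx := by
    rw [Pi.add_apply, h.eq_zero K hK hE x hx, h'.eq_zero K hK hE x hx, add_zero]
  eq_smul K hK p hp q hq hpq hA := by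
    obtain ⟨a, h1, h2⟩ := h.eq_smul K hK p hp q hq hpq hA
    obtain ⟨a', h1', h2'⟩ := h'.eq_smul K hK p hp q hq hpq hA
    refine ⟨a + a', ?_, fun x hx => ?_⟩
    · rw [Pi.add_apply, h1, h1']
      exact (add_smul a a' (edgeDeriv K p q)).symm
    rw [Pi.add_apply, h2 x hx, h2' x hx, add_smul]
  cancel K hK := by
    simp only [Pi.add_apply, map_add, smul_add, Finset.sum_add_distrib, h.cancel K hK,
      h'.cancel K hK]
    exact add_zero 0

theorem IsClassField.smul {A : Set (Finset E3)} {u : E3 → E3} {D : Finset E3 → E3 →L[ℝ] E3}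
    (h : IsClassField M T A u D) (c : ℝ) : IsClassField M T A (c • u) (c • D) where
  hasFDerivAt K hK x hx := (h.hasFDerivAt K hK x hx).const_smul c
  eq_zero K hK hE x hx := by
    rw [Pi.smul_apply, h.eq_zero K hK hE x hx, smul_zero]
  eq_smul K hK p hp q hq hpq hA := by
    obtain ⟨a, h1, h2⟩ := h.eq_smul K hK p hp q hq hpq hA
    refine ⟨c * a, ?_, fun x hx => ?_⟩
    · rw [Pi.smul_apply, h1]
      exact (mul_smul c a (edgeDeriv K p q)).symm
    rw [Pi.smul_apply, h2 x hx, mul_smul]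
  cancel K hK := by
    simp only [Pi.smul_apply, map_smul, smul_comm _ c, ← Finset.smul_sum, h.cancel K hK, smul_zero]

theorem exists_isClassField (hΩ : IsOpen Ω) (hM : IsMesh Ω ΓD M) (hT : IsMesh Ω ΓD T)
    (hMT : Refines M T) (hc : Conforming Ω T) {A : Set (Finset E3)}
    (hcard : ∀ E ∈ A, E.card = 2)
    (hsep : ∀ K ∈ T, ∀ E ∈ A, ∀ E' ∈ A, E ⊆ K → E' ⊆ K → E = E') {u : E3 → E3}
    (hu : u ∈ edgeSpan T A) : ∃ D, IsClassField M T A u D := by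
  classical
  refine Submodule.span_induction (p := fun u _ => ∃ D, IsClassField M T A u D) ?_ ?_ ?_ ?_ hu
  · rintro _ ⟨E, hE, p, hp, q, hq, hpq, rfl⟩
    have hEe : E = {p, q} := by
      symm
      apply Finset.eq_of_subset_of_card_le
      · exact pair_subset ⟨hp, hq⟩
      · rw [hcard E hE, Finset.card_pair hpq]
    exact ⟨_, isClassField_edgeBasis hΩ hM hT hMT hc hsep hpq (hEe ▸ hE)⟩
  · exact ⟨_, IsClassField.zero⟩
  · rintro f g - - ⟨D, h⟩ ⟨D', h'⟩
    exact ⟨_, h.add h'⟩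
  · rintro c f - ⟨D, h⟩
    exact ⟨_, h.smul c⟩

/-! ### Estimates for the fields of one class -/

section ClassField

variable {A : Set (Finset E3)} {u : E3 → E3} {D : Finset E3 → E3 →L[ℝ] E3}

theorem IsClassField.curl_eq (h : IsClassField M T A u D) {K : Finset E3} (hK : K ∈ T) {x : E3}
    (hx : x ∈ interior (body K)) : curl u x = curlMap (D K) :=
  curl_eq_curlMap (h.hasFDerivAt K hK x hx)

theorem memLp_of_const (hT : IsMesh Ω ΓD T) {f : E3 → E3} {c : Finset E3 → E3}
    (hf : ∀ K ∈ T, ∀ x ∈ interior (body K), f x = c K) : MemLp f 2 (volume.restrict Ω) :=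
  hT.memLp fun K hK => ⟨fun _ => c K, continuous_const, hf K hK⟩

theorem continuous_edgeLocal {K : Finset E3} (h : IsTet K) {p q : E3} (hp : p ∈ K) (hq : q ∈ K) :
    Continuous (edgeLocal K p q) :=
  continuous_iff_continuousAt.2 fun x => (hasFDerivAt_edgeLocal h hp hq x).continuousAt

/-- Either no edge of the class belongs to the element, or there is one. -/
theorem IsClassField.eq_zero_or_eq_smul (h : IsClassField M T A u D)
    (hcard : ∀ E ∈ A, E.card = 2) {K : Finset E3} (hK : K ∈ T) :
    (∀ x ∈ interior (body K), u x = 0) ∨ ∃ E ∈ A, E ⊆ K ∧ ∃ p ∈ K, ∃ q ∈ K, p ≠ q ∧ ∃ a : ℝ,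
      D K = a • edgeDeriv K p q ∧ ∀ x ∈ interior (body K), u x = a • edgeLocal K p q x := by
  classical
  by_cases hE : ∀ E ∈ A, ¬ E ⊆ K
  · exact Or.inl (h.eq_zero K hK hE)
  · push Not at hE
    obtain ⟨E, hEA, hEK⟩ := hE
    obtain ⟨p, q, hpq, rfl⟩ := Finset.card_eq_two.1 (hcard E hEA)
    have hp : p ∈ K := hEK (by simp)
    have hq : q ∈ K := hEK (by simp)
    exact Or.inr ⟨_, hEA, hEK, p, hp, q, hq, hpq, h.eq_smul K hK p hp q hq hpq hEA⟩

theorem IsClassField.memLp (h : IsClassField M T A u D) (hcard : ∀ E ∈ A, E.card = 2)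
    (hT : IsMesh Ω ΓD T) : MemLp u 2 (volume.restrict Ω) := by
  refine hT.memLp fun K hK => ?_
  rcases h.eq_zero_or_eq_smul hcard hK with h0 | ⟨E, -, -, p, hp, q, hq, -, a, -, ha⟩
  · exact ⟨0, continuous_const, h0⟩
  · exact ⟨_, (continuous_edgeLocal (hT.isTet K hK) hp hq).const_smul a, ha⟩

/-- A field spanned by the basis functions of one class is bounded by its curl. -/
theorem IsClassField.normL2_le (h : IsClassField M T A u D) (hcard : ∀ E ∈ A, E.card = 2)
    (hT : IsMesh Ω ΓD T) {ρ : ℝ} (hρ : ∀ K ∈ T, ∀ E ∈ A, E ⊆ K → shapeMeasure K ≤ ρ) :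
    normL2 Ω u ≤ (2 * ρ) ^ 2 * meshWidth T * normL2 Ω (curl u) := by
  refine normL2_le_mul (mul_nonneg (sq_nonneg _) (meshWidth_nonneg T))
    (memLp_of_const hT fun K hK x hx => h.curl_eq hK hx) ?_
  filter_upwards [hT.ae_mem_interior] with x ⟨K, hK, hx⟩
  rcases h.eq_zero_or_eq_smul hcard hK with h0 | ⟨E, hE, hEK, p, hp, q, hq, hpq, a, hD, ha⟩
  · rw [h0 x hx, norm_zero]
    have := meshWidth_nonneg T
    positivity
  · rw [ha x hx, h.curl_eq hK hx, hD, map_smul, norm_smul, norm_smul]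
    have h1 := norm_edgeLocal_le (hT.isTet K hK) (hρ K hK E hE hEK) hp hq hpq
      (interior_subset hx)
    have h2 : (2 * ρ) ^ 2 * EdgeMG.hK K * ‖curlMap (edgeDeriv K p q)‖
        ≤ (2 * ρ) ^ 2 * meshWidth T * ‖curlMap (edgeDeriv K p q)‖ := by
      have := hK_le_meshWidth hK
      gcongr
    calc ‖a‖ * ‖edgeLocal K p q x‖
        ≤ ‖a‖ * ((2 * ρ) ^ 2 * meshWidth T * ‖curlMap (edgeDeriv K p q)‖) := by
          gcongr
          exact h1.trans h2
      _ = _ := by ring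

open Classical in
/-- The elements at the boundary of `K` occupy a small part of `K`. -/
theorem sum_volume_outer_le (hT : IsMesh Ω ΓD T) (hcard : ∀ E ∈ A, E.card = 2) {K : Finset E3}
    (hKt : IsTet K) {ρ κ : ℝ} (hκ0 : 0 ≤ κ) (hρ : shapeMeasure K ≤ ρ)
    (hκ : ∀ K' ∈ T, body K' ⊆ body K → hK K' ≤ κ * hK K) :
    ∑ K' ∈ T with body K' ⊆ body K ∧ HasOuterEdge A K K', volume.real (body K') ≤
      24 * ρ * κ * volume.real (body K) := by
  set F := T.filter (fun K' => body K' ⊆ body K ∧ HasOuterEdge A K K') with hF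
  have hmem : ∀ K', K' ∈ F ↔ K' ∈ T ∧ body K' ⊆ body K ∧ HasOuterEdge A K K' := fun K' => by
    simp [hF]
  obtain ⟨r, hr, c, hc, hle⟩ := exists_closedBall_subset hKt hρ
  have hρ0 := pos_of_shapeMeasure_le hKt hρ
  -- An outer edge has a vertex where some coordinate of `K` is nonpositive. Over a diameter of at
  -- most `κ * (2 * ρ * r)`, with gradient at most `1 / r`, this coordinate rises by at most `t`.
  set t := 2 * ρ * κ with ht
  have ht0 : 0 ≤ t := by positivity
  have hsub : ∀ K' ∈ F, body K' ⊆ ⋃ j ∈ K, {x ∈ body K | bary K j x ≤ t} := by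
    intro K' hK' x hx
    obtain ⟨h1, h2, E, hEA, hEK, hEd⟩ := (hmem K').1 hK'
    obtain ⟨p, hp⟩ : E.Nonempty := by rw [← Finset.card_pos, hcard E hEA]; norm_num
    have hpi : p ∉ interior (body K) := Set.disjoint_left.1 hEd (mem_body hp)
    rw [mem_interior_body_iff hKt] at hpi
    push Not at hpi
    obtain ⟨j, hj, hjp⟩ := hpi
    simp only [Set.mem_iUnion]
    refine ⟨j, hj, h2 hx, ?_⟩
    have e1 := bary_sub_bary hKt hj p x
    have e2 := real_inner_le_norm (bgrad K j) (x - p)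
    have e3 := dist_le_hK hx (mem_body (hEK hp))
    have e4 := hκ K' h1 h2
    have e5 := mul_norm_bgrad_le hKt hr.le hc hj
    have e6 : ‖bgrad K j‖ * ‖x - p‖ ≤ ‖bgrad K j‖ * (κ * (2 * ρ * r)) := by
      have := (e3.trans e4).trans (mul_le_mul_of_nonneg_left hle hκ0)
      gcongr
    have e7 : ‖bgrad K j‖ * (κ * (2 * ρ * r)) = t * (r * ‖bgrad K j‖) := by rw [ht]; ring
    have e8 : t * (r * ‖bgrad K j‖) ≤ t := mul_le_of_le_one_right ht0 e5
    linarith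
  have hfin : ∀ K' : Finset E3, volume (interior (body K')) ≠ ⊤ := fun K' => by
    rw [volume_interior_body]; exact volume_body_ne_top K'
  have e1 : ∑ K' ∈ F, volume.real (body K') = volume.real (⋃ K' ∈ F, interior (body K')) := by
    rw [measureReal_biUnion_finset (h := fun K' _ => hfin K')]
    · refine Finset.sum_congr rfl fun K' _ => ?_
      rw [measureReal_def, measureReal_def, volume_interior_body]
    · intro K₁ h₁ K₂ h₂ hne
      exact hT.disjoint K₁ ((hmem _).1 h₁).1 K₂ ((hmem _).1 h₂).1 hne
    · exact fun K' _ => isOpen_interior.measurableSet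
  rw [e1]
  calc volume.real (⋃ K' ∈ F, interior (body K'))
      ≤ volume.real (⋃ j ∈ K, {x ∈ body K | bary K j x ≤ t}) := by
        refine measureReal_mono
          (Set.iUnion₂_subset fun K' hK' => interior_subset.trans (hsub K' hK')) ?_
        exact measure_ne_top_of_subset (Set.iUnion₂_subset fun j _ x hx => hx.1)
          (volume_body_ne_top K)
    _ ≤ ∑ j ∈ K, volume.real {x ∈ body K | bary K j x ≤ t} := measureReal_biUnion_finset_le _ _
    _ ≤ ∑ j ∈ K, 3 * t * volume.real (body K) :=
        Finset.sum_le_sum fun j hj => volume_strip_le hKt hj ht0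
    -- Four faces, the factor 3 of the strip estimate, and 2 from `t`.
    _ = 24 * ρ * κ * volume.real (body K) := by
        rw [Finset.sum_const, hKt.1, ht]
        simp only [nsmul_eq_mul, Nat.cast_ofNat]
        ring

open Classical in
theorem sum_eq_sum_parent (hM : IsMesh Ω ΓD M) (hT : IsMesh Ω ΓD T) (hMT : Refines M T)
    (f : Finset E3 → ℝ) :
    ∑ K' ∈ T, f K' = ∑ K ∈ M, ∑ K' ∈ T with body K' ⊆ body K, f K' := by
  choose! π hπ hsub using hMT.parent
  rw [← Finset.sum_fiberwise_of_maps_to hπ]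
  refine Finset.sum_congr rfl fun K hK => ?_
  refine Finset.sum_congr (Finset.filter_congr fun K' hK' => ?_) fun _ _ => rfl
  constructor
  · rintro rfl
    exact hsub K' hK'
  · exact fun h => hM.eq_of_body_subset (hT.isTet K' hK') (hπ K' hK') hK (hsub K' hK') h

/-- The strengthened Cauchy-Schwarz inequality. -/
theorem IsClassField.innerL2_curl_le (h : IsClassField M T A u D) (hcard : ∀ E ∈ A, E.card = 2)
    (hM : IsMesh Ω ΓD M) (hT : IsMesh Ω ΓD T) (hMT : Refines M T) {ρ κ : ℝ} (hρ0 : 0 ≤ ρ)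
    (hκ0 : 0 ≤ κ) (hρ : ShapeRegular ρ M)
    (hκ : ∀ K ∈ M, ∀ K' ∈ T, body K' ⊆ body K → hK K' ≤ κ * hK K)
    {v : E3 → E3} {B : Finset E3 → E3} (hv : ∀ K ∈ M, ∀ x ∈ interior (body K), curl v x = B K) :
    innerL2 Ω (curl v) (curl u) ≤ √(24 * ρ * κ) * normL2 Ω (curl v) * normL2 Ω (curl u) := by
  classical
  set G : Finset E3 → E3 := fun K => curlMap (D K) with hG
  have hu : ∀ K ∈ T, ∀ x ∈ interior (body K), curl u x = G K := fun K hK x hx => h.curl_eq hK hx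
  choose! π hπ hsub using hMT.parent
  set a : Finset E3 → ℝ := fun K => ∑ K' ∈ T with body K' ⊆ body K,
    volume.real (body K') * ‖G K'‖ ^ 2 with ha
  have ha0 : ∀ K, 0 ≤ a K := fun K => Finset.sum_nonneg fun _ _ => by positivity
  -- reduction to sums
  have e1 : innerL2 Ω (curl v) (curl u) =
      ∑ K ∈ M, ∑ K' ∈ T with body K' ⊆ body K, volume.real (body K') * ⟪B K, G K'⟫ := by
    rw [innerL2, hT.integral_eq (c := fun K' => ⟪B (π K'), G K'⟫), sum_eq_sum_parent hM hT hMT]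
    · refine Finset.sum_congr rfl fun K hK => Finset.sum_congr rfl fun K' hK' => ?_
      rw [Finset.mem_filter] at hK'
      rw [hM.eq_of_body_subset (hT.isTet K' hK'.1) (hπ K' hK'.1) hK (hsub K' hK'.1) hK'.2]
    · intro K' hK' x hx
      rw [hu K' hK' x hx, hv (π K') (hπ K' hK') x (interior_mono (hsub K' hK') hx)]
  have e2 : normL2 Ω (curl u) = √(∑ K ∈ M, a K) := by
    rw [hT.normL2_sq hu, sum_eq_sum_parent hM hT hMT]
  -- the estimate on one coarse element
  have e3 : ∀ K ∈ M, ∑ K' ∈ T with body K' ⊆ body K, volume.real (body K') * ⟪B K, G K'⟫ ≤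
      √(24 * ρ * κ) * (√(volume.real (body K) * ‖B K‖ ^ 2) * √(a K)) := by
    intro K hK
    -- The constant `B K` leaves the sum, and the tetrahedra that are not outer drop out by
    -- `cancel`.
    have f1 : ∑ K' ∈ T with body K' ⊆ body K, volume.real (body K') * ⟪B K, G K'⟫ =
        ⟪B K, ∑ K' ∈ T with body K' ⊆ body K ∧ HasOuterEdge A K K',
          volume.real (body K') • G K'⟫ := by
      have := h.cancel K hK
      rw [← add_zero (∑ K' ∈ T with body K' ⊆ body K ∧ HasOuterEdge A K K', _), ← this,
        ← Finset.filter_filter, ← Finset.filter_filter, Finset.sum_filter_add_sum_filter_not,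
        inner_sum]
      exact Finset.sum_congr rfl fun K' _ => by rw [inner_smul_right]
    -- Cauchy-Schwarz with the volumes as weights: one factor is the root of the volume of the
    -- strip, the other part of the norm of `curl u` on `K`.
    have f2 : ‖∑ K' ∈ T with body K' ⊆ body K ∧ HasOuterEdge A K K',
        volume.real (body K') • G K'‖ ≤ √(24 * ρ * κ * volume.real (body K)) * √(a K) := by
      refine (norm_sum_le _ _).trans ?_
      have g1 : ∀ K' ∈ T.filter (fun K' => body K' ⊆ body K ∧ HasOuterEdge A K K'),
          ‖volume.real (body K') • G K'‖ =
            √(volume.real (body K')) * √(volume.real (body K') * ‖G K'‖ ^ 2) := by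
        intro K' _
        have hv0 : 0 ≤ volume.real (body K') := measureReal_nonneg
        rw [norm_smul, Real.norm_eq_abs, abs_of_nonneg hv0, ← Real.sqrt_mul hv0, ← mul_assoc,
          Real.sqrt_mul (by positivity), Real.sqrt_mul_self hv0, Real.sqrt_sq (norm_nonneg _)]
      rw [Finset.sum_congr rfl g1]
      refine (Real.sum_sqrt_mul_sqrt_le _ (fun _ => measureReal_nonneg)
        fun _ => by positivity).trans ?_
      gcongr
      · exact sum_volume_outer_le hT hcard (hM.isTet K hK) hκ0 (hρ K hK) (hκ K hK)
      · refine Finset.sum_le_sum_of_subset_of_nonneg ?_ fun _ _ _ => by positivity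
        rw [← Finset.filter_filter]
        exact Finset.filter_subset _ _
    rw [f1]
    refine (real_inner_le_norm _ _).trans ?_
    refine (mul_le_mul_of_nonneg_left f2 (norm_nonneg _)).trans (le_of_eq ?_)
    rw [Real.sqrt_mul (by positivity), Real.sqrt_mul measureReal_nonneg,
      Real.sqrt_sq (norm_nonneg _)]
    ring
  rw [e1, e2, hM.normL2_sq hv, mul_assoc]
  refine (Finset.sum_le_sum e3).trans ?_
  rw [← Finset.mul_sum]
  refine mul_le_mul_of_nonneg_left ?_ (Real.sqrt_nonneg _)
  exact Real.sum_sqrt_mul_sqrt_le _ (fun _ => by positivity) ha0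

end ClassField

end EdgeMG

namespace EdgeMG

variable {Ω ΓD : Set E3} {L : ℕ} {T That : ℕ → Mesh}

/-! ### Local and global mesh widths -/

theorem EqualSplitting.volume_eq (hC : ∀ k ≤ L, IsMesh Ω ΓD (That k))
    (hn : ∀ k < L, Nested (That k) (That (k + 1))) {N : ℕ} (hN : EqualSplitting L That N)
    {m l : ℕ} (hml : m ≤ l) (hl : l ≤ L) {K : Finset E3} (hK : K ∈ That m) :
    ∀ K' ∈ That l, body K' ⊆ body K →
      volume.real (body K) = N ^ (l - m) * volume.real (body K') := by
  induction l, hml using Nat.le_induction with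
  | base =>
    intro K' hK' hsub
    rw [(hC m hl).eq_of_body_subset ((hC m hl).isTet K' hK') hK' hK le_rfl hsub]
    simp
  | succ l hml ih =>
    intro K' hK' hsub
    obtain ⟨K₁, h1, h2⟩ := ((hn l (by omega)).refines (hC l (by omega)) (hC _ hl)).parent K' hK'
    obtain ⟨K₂, h3, h4⟩ := (refines_of_nested hC hn hml (by omega)).parent K₁ h1
    have h5 := (hC m (by omega)).eq_of_body_subset ((hC _ hl).isTet K' hK') hK h3 hsub (h2.trans h4)
    rw [ih (by omega) K₁ h1 (h5 ▸ h4), hN l (by omega) K₁ h1 K' hK' h2, ← mul_assoc, ← pow_succ,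
      Nat.succ_sub hml]

/-- With `volume_body_le`, this makes the cubed diameter comparable to the volume. -/
theorem hK_pow_le {K : Finset E3} (h : IsTet K) {ρ : ℝ} (hρ : shapeMeasure K ≤ ρ) :
    hK K ^ 3 * volume.real (Metric.ball (0 : E3) 1) ≤ (2 * ρ) ^ 3 * volume.real (body K) := by
  obtain ⟨r, hr, c, hc, hle⟩ := exists_closedBall_subset h hρ
  have h0 := pos_of_shapeMeasure_le h hρ
  have h1 := measureReal_mono hc (volume_body_ne_top K)
  rw [volume_real_closedBall c hr.le] at h1
  have h2 : hK K ^ 3 ≤ (2 * ρ * r) ^ 3 := pow_le_pow_left₀ (hK_nonneg K) hle 3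
  have := volume_real_unitBall_pos
  calc _ ≤ (2 * ρ * r) ^ 3 * volume.real (Metric.ball (0 : E3) 1) := by gcongr
    _ = (2 * ρ) ^ 3 * (r ^ 3 * volume.real (Metric.ball (0 : E3) 1)) := by ring
    _ ≤ _ := by gcongr

theorem IsCompanion.refines (hT : IsRefinementHierarchy Ω ΓD L T)
    (hC : IsCompanion Ω ΓD L T That) {m : ℕ} (hm : m ≤ L) : Refines (T m) (That m) :=
  (hC.nested' m hm).refines (hT.isMesh m hm) (hC.isMesh m hm)

/-- The volume ratio between levels `m` and `l` of the companion is `N ^ (l - m)` everywhere, so it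
serves both the local ratio of diameters and the ratio of mesh widths. Each passage between volume
and diameter costs a factor `2 * ρ`. -/
theorem IsCompanion.hK_le_of_equalSplitting (hT : IsRefinementHierarchy Ω ΓD L T)
    (hC : IsCompanion Ω ΓD L T That) {N : ℕ} (hN : EqualSplitting L That N) {ρ : ℝ} (hρ0 : 0 ≤ ρ)
    (hρ : ∀ k ≤ L, ShapeRegular ρ (That k)) {m l : ℕ} (hml : m ≤ l) (hl : l ≤ L)
    {K K' : Finset E3} (hK : K ∈ T m) (hK' : K' ∈ That l) (hsub : body K' ⊆ body K) :
    EdgeMG.hK K' ≤ (2 * ρ) ^ 2 * (meshWidth (That l) / meshWidth (That m)) * EdgeMG.hK K := by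
  have hm := hml.trans hl
  have hr := refines_of_nested hC.isMesh hC.nested hml hl
  have htet' : ∀ K ∈ That l, IsTet K := (hC.isMesh l hl).isTet
  obtain ⟨K₁, hK₁, hs₁⟩ := hr.parent K' hK'
  have hK₁K : EdgeMG.hK K₁ ≤ EdgeMG.hK K := by
    obtain ⟨K₂, hK₂, hs₂⟩ := (hC.refines hT hm).parent K₁ hK₁
    rw [(hT.isMesh m hm).eq_of_body_subset (htet' K' hK') hK hK₂ hsub (hs₁.trans hs₂)]
    exact hK_mono hs₂
  -- The pair `M`, `M'` carries the global ratio, and `K₁`, `K'` the local one; `K₁` lies in `K`,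
  -- which may be coarser than `That m`.
  obtain ⟨M, hM, hMw⟩ := exists_hK_eq_meshWidth ⟨K₁, hK₁⟩
  obtain ⟨M', hM', hs'⟩ := hr.child M hM
  have htetM := (hC.isMesh m hm).isTet M hM
  have hβ := volume_real_unitBall_pos
  have v1 := EqualSplitting.volume_eq hC.isMesh hC.nested hN hml hl hK₁ K' hK' hs₁
  have v2 := EqualSplitting.volume_eq hC.isMesh hC.nested hN hml hl hM M' hM' hs'
  have a1 := hK_pow_le (htet' K' hK') (hρ l hl K' hK')
  have a2 := hK_pow_le htetM (hρ m hm M hM)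
  have a3 := volume_body_le ((hC.isMesh m hm).isTet K₁ hK₁)
  have a4 := volume_body_le (htet' M' hM')
  have hw := meshWidth_nonneg (That l)
  have hM'w : EdgeMG.hK M' ≤ meshWidth (That l) := hK_le_meshWidth hM'
  have hwpos : 0 < meshWidth (That m) := hMw ▸ hK_pos htetM
  rw [hMw] at a2
  set V : ℝ := (N : ℝ) ^ (l - m) with hV
  have hV0 : 0 ≤ V := by positivity
  set β := volume.real (Metric.ball (0 : E3) 1)
  have h0 := hK_nonneg K
  have h0' := hK_nonneg K'
  have h0₁ := hK_nonneg K₁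
  have h0M := hK_nonneg M'
  have b1 : meshWidth (That m) ^ 3 ≤ (2 * ρ) ^ 3 * V * meshWidth (That l) ^ 3 := by
    refine le_of_mul_le_mul_right ?_ hβ
    calc _ ≤ (2 * ρ) ^ 3 * (V * volume.real (body M')) := v2 ▸ a2
      _ ≤ (2 * ρ) ^ 3 * (V * (meshWidth (That l) ^ 3 * β)) := by
        have : EdgeMG.hK M' ^ 3 * β ≤ meshWidth (That l) ^ 3 * β := by gcongr
        have := a4.trans this
        gcongr
      _ = _ := by ring
  have b2 : V * EdgeMG.hK K' ^ 3 ≤ (2 * ρ) ^ 3 * EdgeMG.hK K ^ 3 := by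
    refine le_of_mul_le_mul_right ?_ hβ
    calc V * EdgeMG.hK K' ^ 3 * β = V * (EdgeMG.hK K' ^ 3 * β) := by ring
      _ ≤ V * ((2 * ρ) ^ 3 * volume.real (body K')) := by gcongr
      _ = (2 * ρ) ^ 3 * volume.real (body K₁) := by rw [v1]; ring
      _ ≤ (2 * ρ) ^ 3 * (EdgeMG.hK K₁ ^ 3 * β) := by gcongr
      _ ≤ (2 * ρ) ^ 3 * (EdgeMG.hK K ^ 3 * β) := by gcongr
      _ = _ := by ring
  have b3 : (EdgeMG.hK K' * meshWidth (That m)) ^ 3 ≤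
      ((2 * ρ) ^ 2 * meshWidth (That l) * EdgeMG.hK K) ^ 3 := by
    calc (EdgeMG.hK K' * meshWidth (That m)) ^ 3
        = EdgeMG.hK K' ^ 3 * meshWidth (That m) ^ 3 := by ring
      _ ≤ EdgeMG.hK K' ^ 3 * ((2 * ρ) ^ 3 * V * meshWidth (That l) ^ 3) := by gcongr
      _ = (2 * ρ) ^ 3 * meshWidth (That l) ^ 3 * (V * EdgeMG.hK K' ^ 3) := by ring
      _ ≤ (2 * ρ) ^ 3 * meshWidth (That l) ^ 3 * ((2 * ρ) ^ 3 * EdgeMG.hK K ^ 3) := by gcongr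
      _ = _ := by ring
  have b4 := le_of_pow_le_pow_left₀ (by norm_num) (by positivity) b3
  rw [← le_div_iff₀ hwpos] at b4
  refine b4.trans (le_of_eq ?_)
  ring

/-- One factor `C₀` bounds the mesh width of `That m` from above, the other bounds the diameter of
an element of `That m` inside `K` from below. -/
theorem IsCompanion.hK_le_of_quasiUniform (hT : IsRefinementHierarchy Ω ΓD L T)
    (hC : IsCompanion Ω ΓD L T That) {C₀ θ : ℝ} (hQ : QuasiUniform L That C₀ θ) {m l : ℕ}
    (hm : m ≤ L)
    {K K' : Finset E3} (hK : K ∈ T m) (hK' : K' ∈ That l) :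
    EdgeMG.hK K' ≤ C₀ ^ 2 * (meshWidth (That l) / meshWidth (That m)) * EdgeMG.hK K := by
  obtain ⟨hC₀, hθ, -, hbd⟩ := hQ
  obtain ⟨K₁, hK₁, hs₁⟩ := (hC.refines hT hm).child K hK
  obtain ⟨M, hM, hMw⟩ := exists_hK_eq_meshWidth ⟨K₁, hK₁⟩
  have hwpos : 0 < meshWidth (That m) := hMw ▸ hK_pos ((hC.isMesh m hm).isTet M hM)
  have h1 : C₀⁻¹ * θ ^ m ≤ EdgeMG.hK K := ((hbd m hm K₁ hK₁).1).trans (hK_mono hs₁)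
  have h2 : meshWidth (That m) ≤ C₀ * θ ^ m := hMw ▸ (hbd m hm M hM).2
  have h3 : meshWidth (That m) ≤ C₀ ^ 2 * EdgeMG.hK K := by
    calc _ ≤ C₀ * θ ^ m := h2
      _ = C₀ ^ 2 * (C₀⁻¹ * θ ^ m) := by field_simp
      _ ≤ _ := by gcongr
  have h4 : EdgeMG.hK K' ≤ meshWidth (That l) := hK_le_meshWidth hK'
  calc EdgeMG.hK K' ≤ meshWidth (That l) / meshWidth (That m) * meshWidth (That m) := by
        rwa [div_mul_cancel₀ _ hwpos.ne']
    _ ≤ meshWidth (That l) / meshWidth (That m) * (C₀ ^ 2 * EdgeMG.hK K) := by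
        have := meshWidth_nonneg (That l)
        gcongr
    _ = _ := by ring

/-! ### Edge classes in the refinement zone -/

section Colouring

variable {l P : ℕ} {cls : Fin P → Set (Finset E3)}

theorem IsColouring.mem_zoneEdges (h : IsColouring ΓD L T That l cls) {i : Fin P} {E : Finset E3}
    (hE : E ∈ cls i) : E ∈ zoneEdges ΓD L T That l := by
  rw [← h.union]
  exact Set.mem_iUnion.2 ⟨i, hE⟩

theorem IsColouring.card_eq_two (h : IsColouring ΓD L T That l cls) {i : Fin P} {E : Finset E3}
    (hE : E ∈ cls i) : E.card = 2 := (h.mem_zoneEdges hE).2.1.1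

theorem IsColouring.body_subset_zone (h : IsColouring ΓD L T That l cls)
    (hC : IsCompanion Ω ΓD L T That) (hl : l ≤ L) {i : Fin P} {E K : Finset E3} (hE : E ∈ cls i)
    (hK : K ∈ That l) (hEK : E ⊆ K) : body K ⊆ closure (zone L T l) := by
  obtain ⟨p, hp, q, hq, hpq⟩ := Finset.one_lt_card.1 (h.card_eq_two hE ▸ one_lt_two)
  exact (body_subset_tsupport (hC.isMesh l hl) hK (hEK hp) (hEK hq) hpq).trans
    ((h.mem_zoneEdges hE).2.2 p hp q hq hpq)

/-- An element with an edge of the class lies in the support of a basis function, hence in the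
closed zone. Thus the separation and the shape regularity assumed on `T l` carry over to the part of
`That l` where `u` lives. -/
theorem IsColouring.mem_of_subset (h : IsColouring ΓD L T That l cls)
    (hT : IsRefinementHierarchy Ω ΓD L T) (hC : IsCompanion Ω ΓD L T That) (hl : l ≤ L) {i : Fin P}
    {E K : Finset E3} (hE : E ∈ cls i) (hK : K ∈ That l) (hEK : E ⊆ K) : K ∈ T l :=
  mem_of_body_subset_zone hT hC hl hK (h.body_subset_zone hC hl hE hK hEK)

theorem IsColouring.eq_of_subset (h : IsColouring ΓD L T That l cls)
    (hT : IsRefinementHierarchy Ω ΓD L T) (hC : IsCompanion Ω ΓD L T That) (hl : l ≤ L) (i : Fin P)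
    (K : Finset E3) (hK : K ∈ That l) (E : Finset E3) (hE : E ∈ cls i) (E' : Finset E3)
    (hE' : E' ∈ cls i) (hEK : E ⊆ K) (hEK' : E' ⊆ K) : E = E' :=
  h.separated K (h.mem_of_subset hT hC hl hE hK hEK) (h.body_subset_zone hC hl hE hK hEK) i E hE E'
    hE' hEK hEK'

end Colouring

theorem normL2_nonneg (Ω : Set E3) (f : E3 → E3) : 0 ≤ normL2 Ω f := Real.sqrt_nonneg _

end EdgeMG

/-! ### The three bounds -/

theorem lemma6p2 (ρ : ℝ) :
    ∃ C : ℝ, 0 < C ∧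
      ∀ (Ω ΓD : Set EdgeMG.E3) (L : ℕ) (T That : ℕ → EdgeMG.Mesh),
        IsOpen Ω → ΓD ⊆ frontier Ω →
        EdgeMG.IsRefinementHierarchy Ω ΓD L T →
        EdgeMG.IsCompanion Ω ΓD L T That →
        (∀ l ≤ L, EdgeMG.ShapeRegular ρ (T l)) →
        ∀ m l : ℕ, m ≤ l → l ≤ L →
        ∀ (P : ℕ) (cls : Fin P → Set (Finset EdgeMG.E3)),
          EdgeMG.IsColouring ΓD L T That l cls →
        ∀ i : Fin P,
        ∀ U, EdgeMG.IsEdgeSpace Ω ΓD (T m) U →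
        ∀ v ∈ U,
        ∀ u ∈ EdgeMG.edgeSpan (That l) (cls i),
          (∀ N : ℕ, EdgeMG.EqualSplitting L That N →
            (∀ k ≤ L, EdgeMG.ShapeRegular ρ (That k)) →
            EdgeMG.innerL2 Ω (EdgeMG.curl v) (EdgeMG.curl u) ≤
              C * √(EdgeMG.meshWidth (That l) / EdgeMG.meshWidth (That m)) *
                EdgeMG.normL2 Ω (EdgeMG.curl v) * EdgeMG.normL2 Ω (EdgeMG.curl u)) ∧
          (∀ C₀ θ : ℝ, EdgeMG.QuasiUniform L That C₀ θ →
            EdgeMG.innerL2 Ω (EdgeMG.curl v) (EdgeMG.curl u) ≤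
              C * C₀ * √(EdgeMG.meshWidth (That l) / EdgeMG.meshWidth (That m)) *
                EdgeMG.normL2 Ω (EdgeMG.curl v) * EdgeMG.normL2 Ω (EdgeMG.curl u)) ∧
          EdgeMG.innerL2 Ω v u ≤
            C * EdgeMG.meshWidth (That l) *
              EdgeMG.normL2 Ω v * EdgeMG.normL2 Ω (EdgeMG.curl u) := by
  -- The maximum keeps the constant positive for every real `ρ`.
  set ρ' := max ρ 1 with hρ'
  have hρ1 : 0 < ρ' := lt_of_lt_of_le one_pos (le_max_right _ _)
  set c := √(24 * ρ') with hc
  have hc0 : 0 ≤ c := Real.sqrt_nonneg _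
  -- The summands serve the third, the first and the second bound, in this order.
  refine ⟨(2 * ρ') ^ 2 + c * (2 * ρ') + c, by positivity, ?_⟩
  intro Ω ΓD L T That hΩ _ hT hC hreg m l hml hl P cls hcls i U hU v hv u hu
  have hm := hml.trans hl
  have hTl := hC.isMesh l hl
  have hTm := hT.isMesh m hm
  have href : EdgeMG.Refines (T m) (That l) :=
    (EdgeMG.refines_of_nested hT.isMesh hT.nested hml hl).trans (hC.refines hT hl)
  have hcard : ∀ E ∈ cls i, E.card = 2 := fun E hE => hcls.card_eq_two hE
  have hreg' : EdgeMG.ShapeRegular ρ' (T m) := fun K hK => (hreg m hm K hK).trans (le_max_left _ _)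
  obtain ⟨D, hD⟩ := EdgeMG.exists_isClassField hΩ hTm hTl href (hC.conforming l hl) hcard
    (hcls.eq_of_subset hT hC hl i) hu
  have hw := hU.isLocallyWhitney hv
  obtain ⟨B, hB⟩ := hw.exists_curl
  have hnv := EdgeMG.normL2_nonneg Ω (EdgeMG.curl v)
  have hnu := EdgeMG.normL2_nonneg Ω (EdgeMG.curl u)
  have hwl := EdgeMG.meshWidth_nonneg (That l)
  have hwm := EdgeMG.meshWidth_nonneg (That m)
  set R := EdgeMG.meshWidth (That l) / EdgeMG.meshWidth (That m) with hR
  have hR0 : 0 ≤ R := by positivity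
  -- The ratio bound has the form `κ = A ^ 2 * R`, so its root is `A * √R`: `A` is `2 * ρ'` under
  -- equal splitting and `C₀` under quasi-uniformity, hence the linear dependence on `C₀`.
  have main : ∀ A : ℝ, 0 ≤ A → (∀ K ∈ T m, ∀ K' ∈ That l, EdgeMG.body K' ⊆ EdgeMG.body K →
      EdgeMG.hK K' ≤ A ^ 2 * R * EdgeMG.hK K) →
      EdgeMG.innerL2 Ω (EdgeMG.curl v) (EdgeMG.curl u) ≤
        c * A * √R * EdgeMG.normL2 Ω (EdgeMG.curl v) * EdgeMG.normL2 Ω (EdgeMG.curl u) := by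
    intro A hA hκ
    have := hD.innerL2_curl_le hcard hTm hTl href hρ1.le (by positivity) hreg' hκ hB
    rwa [← mul_assoc, Real.sqrt_mul (by positivity), Real.sqrt_mul (by positivity),
      Real.sqrt_sq hA] at this
  refine ⟨fun N hN hρN => ?_, fun C₀ θ hQ => ?_, ?_⟩
  · refine (main (2 * ρ') (by positivity) fun K hK K' hK' hsub =>
      hC.hK_le_of_equalSplitting hT hN hρ1.le (fun k hk K hK => (hρN k hk K hK).trans
        (le_max_left _ _)) hml hl hK hK' hsub).trans ?_
    gcongr
    nlinarith [sq_nonneg (2 * ρ')]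
  · have hC₀ : 0 < C₀ := hQ.1
    refine (main C₀ hC₀.le fun K hK K' hK' _ =>
      hC.hK_le_of_quasiUniform hT hQ hm hK hK').trans ?_
    gcongr
    have : 0 ≤ c * (2 * ρ') := by positivity
    nlinarith [sq_nonneg (2 * ρ')]
  · have h1 := EdgeMG.abs_innerL2_le (hw.memLp hTm) (hD.memLp hcard hTl)
    have h2 := hD.normL2_le hcard hTl (ρ := ρ') fun K hK E hE hEK =>
      (hreg l hl K (hcls.mem_of_subset hT hC hl hE hK hEK)).trans (le_max_left _ _)
    have hnv' := EdgeMG.normL2_nonneg Ω v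
    have h3 : (2 * ρ') ^ 2 ≤ (2 * ρ') ^ 2 + c * (2 * ρ') + c := by
      have : 0 ≤ c * (2 * ρ') := by positivity
      linarith
    calc EdgeMG.innerL2 Ω v u ≤ EdgeMG.normL2 Ω v * EdgeMG.normL2 Ω u := (le_abs_self _).trans h1
      _ ≤ EdgeMG.normL2 Ω v *
          ((2 * ρ') ^ 2 * EdgeMG.meshWidth (That l) * EdgeMG.normL2 Ω (EdgeMG.curl u)) := by gcongr
      _ = (2 * ρ') ^ 2 * EdgeMG.meshWidth (That l) * EdgeMG.normL2 Ω v *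
          EdgeMG.normL2 Ω (EdgeMG.curl u) := by ring
      _ ≤ _ := by gcongr
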